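/- Let $X$ be a CAT(0) space, $\mathfrak o\in X$, and let $b:[0,\infty)\to X$ be a geodesic ray with $b(0)=\mathfrak o$. Let $\kappa:[0,\infty)\to[1,\infty)$ be a sublinear function, that is, a monotone increasing (not necessarily strictly), concave function with $\lim_{t\to\infty}\kappa(t)/t=0$. *Curtain model.* A curtain is a set $h=\pi_a^{-1}\big(a([r-\tfrac12,r+\tfrac12])\big)$, where $a:I\to X$ is a geodesic defined on a closed interval $I$, $\pi_a$ is the closest point projection to $a$, and $[r-\frac12,r+\frac12]$ is contained in the interior of $I$; its half spaces are $\pi_a^{-1}(a(I\cap(-\infty,r-\frac12)))$ and $\pi_a^{-1}(a(I\cap(r+\frac12,\infty)))$, and $h$ separates two sets if one lies in one half space and the other in the other. A chain is a sequence of pairwise disjoint curtains $h_i$ such that $h_i$ separates $h_{i-1}$ from $h_{i+1}$ for all $i$. Disjoint curtains $h,h'$ are $L$-separated if every chain, all of whose members meet both $h$ and $h'$, has cardinality at most $L$. An $L$-chain is a chain whose members are pairwise $L$-separated. Put $d_L(x,x)=0$ and, for $x\neq y$, $d_L(x,y)=1+\max\{|c| : c \text{ an } L\text{-chain each member of which separates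 } x \text{ from } y\}$. The curtain model is $\widehat X=(X,\hat d)$ with $\hat d(x,y)=\sum_{L=1}^\infty d_L(x,y)/L^3$. For $f:[0,\infty)\to[1,\infty)$, the ray $b$ is *$f$-contracting* if there is $C\ge 0$ such that for every $x\in X$ and every ball $B$ centered at $x$ with $B\cap b=\emptyset$, $\operatorname{diam}(\pi_b(B))<C\,f(d(\mathfrak o,x))$. It has an *$f$-persistent shadow* if there is $C>0$ such that $\hat d(b(s),b(t))\ge C\cdot\frac{t-s}{f(t)}-C$ for all $0\le s<t$. **Theorem.** Suppose that $b$ has infinite diameter in $\widehat X$. 1. If $b$ is $\kappa$-contracting and $\kappa^4$ is sublinear (i.e. $\kappa(t)^4/t\to0$ as $t\to\infty$), then $b$ has a $\kappa^4$-persistent shadow. 2. If $b$ has a $\kappa$-persistent shadow and $\kappa^2$ is sublinear (i.e. $\kappa(t)^2/t\to 0$ as $t\to\infty$), then $b$ is $\kappa^2$-contracting. -/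

import Mathlib

open Set Filter Topology
open scoped ENNReal

/-- `γ` restricted to `I` is a geodesic, i.e. an isometric embedding `I → X`. -/
def IsGeodesicOn {X : Type*} [MetricSpace X] (γ : ℝ → X) (I : Set ℝ) : Prop :=
  ∀ s ∈ I, ∀ t ∈ I, dist (γ s) (γ t) = |s - t|

/-- `γ`, restricted to `[0, d(x,y)]`, is a geodesic segment from `x` to `y`. -/
def IsSegment {X : Type*} [MetricSpace X] (γ : ℝ → X) (x y : X) : Prop :=
  IsGeodesicOn γ (Icc 0 (dist x y)) ∧ γ 0 = x ∧ γ (dist x y) = y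

/-- A CAT(0) space: a geodesic metric space whose geodesic triangles are at least as thin as
their comparison triangles in the Euclidean plane. Points `p`, `q` on two sides of a triangle are
compared with the points `p'`, `q'` of the comparison triangle at the same distances from the
endpoints of the respective sides. Two different sides of a triangle always share a vertex, which
is called `x` here; for two points on one side the comparison inequality is an equality. -/
structure IsCAT0 (X : Type*) [MetricSpace X] : Prop where
  exists_segment : ∀ x y : X, ∃ γ : ℝ → X, IsSegment γ x y
  comparison : ∀ (x y z : X) (α β : ℝ → X), IsSegment α x y → IsSegment β x z →
    ∀ x' y' z' : EuclideanSpace ℝ (Fin 2),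
      dist x' y' = dist x y → dist x' z' = dist x z → dist y' z' = dist y z →
    ∀ p ∈ α '' Icc 0 (dist x y), ∀ q ∈ β '' Icc 0 (dist x z),
    ∀ p' q' : EuclideanSpace ℝ (Fin 2),
      dist x' p' = dist x p → dist p' y' = dist p y →
      dist x' q' = dist x q → dist q' z' = dist q z →
      dist p q ≤ dist p' q'

/-- `p` is a point of `S` that is closest to `x`. If `S` is the image of a geodesic defined on a
nonempty closed interval of a CAT(0) space, there is exactly one such point, namely the closest
point projection of `x` to `S`. -/
def IsClosest {X : Type*} [MetricSpace X] (S : Set X) (x p : X) : Prop :=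
  p ∈ S ∧ ∀ q ∈ S, dist x p ≤ dist x q

/-- The image of `B` under the closest point projection to `S`. -/
def projImage {X : Type*} [MetricSpace X] (S B : Set X) : Set X :=
  {p | ∃ x ∈ B, IsClosest S x p}

/-- The preimage of `A` under the closest point projection to `S`. -/
def projPreimage {X : Type*} [MetricSpace X] (S A : Set X) : Set X :=
  {x | ∃ p ∈ A, IsClosest S x p}

/-- The data defining a curtain: a geodesic `path` on a closed interval `I` (bounded or not) and
a number `r` such that `[r - 1/2, r + 1/2]` lies in the interior of `I`. -/
structure Curtain (X : Type*) [MetricSpace X] where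
  I : Set ℝ
  isClosed_I : IsClosed I
  ordConnected_I : I.OrdConnected
  path : ℝ → X
  isGeodesicOn : IsGeodesicOn path I
  r : ℝ
  pole_subset : Icc (r - 1 / 2) (r + 1 / 2) ⊆ interior I

namespace Curtain

variable {X : Type*} [MetricSpace X]

/-- The curtain as a subset of `X`: the points that project to the pole. -/
def carrier (h : Curtain X) : Set X :=
  projPreimage (h.path '' h.I) (h.path '' Icc (h.r - 1 / 2) (h.r + 1 / 2))

/-- The half space of the points that project before the pole. -/
def neg (h : Curtain X) : Set X :=
  projPreimage (h.path '' h.I) (h.path '' (h.I ∩ Iio (h.r - 1 / 2)))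

/-- The half space of the points that project after the pole. -/
def pos (h : Curtain X) : Set X :=
  projPreimage (h.path '' h.I) (h.path '' (h.I ∩ Ioi (h.r + 1 / 2)))

/-- `h` separates `A` from `B`: they lie in different half spaces of `h`. -/
def Separates (h : Curtain X) (A B : Set X) : Prop :=
  (A ⊆ h.neg ∧ B ⊆ h.pos) ∨ (A ⊆ h.pos ∧ B ⊆ h.neg)

/-- The curtains meet. -/
def Meets (h k : Curtain X) : Prop :=
  (h.carrier ∩ k.carrier).Nonempty

end Curtain

/-- A (finite) chain of `n` curtains: they are pairwise disjoint, and every curtain separates its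
predecessor from its successor. -/
def IsChainOfCurtains {X : Type*} [MetricSpace X] {n : ℕ} (c : Fin n → Curtain X) : Prop :=
  (∀ i j, i ≠ j → Disjoint (c i).carrier (c j).carrier) ∧
  ∀ i j k : Fin n, (i : ℕ) + 1 = j → (j : ℕ) + 1 = k →
    (c j).Separates (c i).carrier (c k).carrier

/-- Disjoint curtains `h`, `k` are `L`-separated if every chain all of whose curtains meet both
`h` and `k` has cardinality at most `L`. -/
def IsLSeparated {X : Type*} [MetricSpace X] (L : ℕ) (h k : Curtain X) : Prop :=
  Disjoint h.carrier k.carrier ∧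
  ∀ (n : ℕ) (c : Fin n → Curtain X), IsChainOfCurtains c →
    (∀ i, (c i).Meets h ∧ (c i).Meets k) → n ≤ L

/-- An `L`-chain: a chain of curtains that are pairwise `L`-separated. -/
def IsLChain {X : Type*} [MetricSpace X] (L : ℕ) {n : ℕ} (c : Fin n → Curtain X) : Prop :=
  IsChainOfCurtains c ∧ ∀ i j, i ≠ j → IsLSeparated L (c i) (c j)

open Classical in
/-- The `L`-metric: `d_L(x,y)` is one more than the largest cardinality of an `L`-chain separating
`x` from `y` if `x ≠ y`, and `d_L(x,x) = 0`. It is finite in a CAT(0) space. -/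
noncomputable def dL {X : Type*} [MetricSpace X] (L : ℕ) (x y : X) : ℝ≥0∞ :=
  if x = y then 0 else
    1 + ⨆ (n : ℕ) (c : Fin n → Curtain X) (_ : IsLChain L c)
      (_ : ∀ i, (c i).Separates {x} {y}), (n : ℝ≥0∞)

/-- The metric of the curtain model: the sum of `d_L(x,y) / L³` over all `L ≥ 1`. -/
noncomputable def dHat {X : Type*} [MetricSpace X] (x y : X) : ℝ≥0∞ :=
  ∑' L : ℕ, dL (L + 1) x y / ((L + 1 : ℕ) : ℝ≥0∞) ^ 3

/-- `b`, restricted to `[0, ∞)`, is a geodesic ray emanating from `o`. -/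
def IsGeodesicRay {X : Type*} [MetricSpace X] (o : X) (b : ℝ → X) : Prop :=
  IsGeodesicOn b (Ici 0) ∧ b 0 = o

/-- The ray `b` has infinite diameter in the curtain model. -/
def HasInfiniteDiamHat {X : Type*} [MetricSpace X] (b : ℝ → X) : Prop :=
  (⨆ (s ∈ Ici (0 : ℝ)) (t ∈ Ici (0 : ℝ)), dHat (b s) (b t)) = ⊤

/-- `f(t) / t → 0` as `t → ∞`. -/
def GrowsSublinearly (f : ℝ → ℝ) : Prop :=
  Tendsto (fun t => f t / t) atTop (𝓝 0)

/-- `κ`, restricted to `[0, ∞)`, is a sublinear function `[0, ∞) → [1, ∞)`, with the usual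
convention that it is monotone and concave. -/
structure IsSublinearFunction (κ : ℝ → ℝ) : Prop where
  one_le : ∀ t, 0 ≤ t → 1 ≤ κ t
  growsSublinearly : GrowsSublinearly κ
  monotoneOn : MonotoneOn κ (Ici 0)
  concaveOn : ConcaveOn ℝ (Ici 0) κ

/-- The ray `b` is `f`-contracting: for some `C ≥ 0`, every ball centred at `x` and disjoint from
`b` has a projection to `b` of diameter less than `C * f(d(o,x))`. -/
def IsContractingRay {X : Type*} [MetricSpace X] (f : ℝ → ℝ) (o : X) (b : ℝ → X) : Prop :=
  ∃ C : ℝ, 0 ≤ C ∧ ∀ (x : X) (ρ : ℝ), 0 < ρ → Disjoint (Metric.ball x ρ) (b '' Ici 0) →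
    Metric.ediam (projImage (b '' Ici 0) (Metric.ball x ρ)) < ENNReal.ofReal (C * f (dist o x))

/-- The ray `b` has an `f`-persistent shadow: for some `C > 0` and all `0 ≤ s < t`, the distance
in the curtain model satisfies `d(b(s), b(t)) ≥ C * (t - s) / f(t) - C`. -/
def HasPersistentShadow {X : Type*} [MetricSpace X] (f : ℝ → ℝ) (b : ℝ → X) : Prop :=
  ∃ C : ℝ, 0 < C ∧ ∀ s t : ℝ, 0 ≤ s → s < t →
    ENNReal.ofReal (C * ((t - s) / f t) - C) ≤ dHat (b s) (b t)

/-!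
Contraction gives a shadow. A `κ`-contracting ray is contracting at a scale `R` comparable to
`κ t` up to time `t`. A segment whose projection to `b` crosses a window of length `2R` in that
range contains a point `R`-close to `b`, with projection in the window. Two curtains dual to `b`
that are `4R + 2` apart are then `L`-separated with `L` comparable to `R`: every curtain meeting
both comes `R`-close to `b` between them, and distinct members of a chain are roughly `1` apart.
So about `(t - s) / κ t` dual curtains form an `L`-chain separating `b s` from `b t`, which
contributes at least a constant multiple of `(t - s) / κ t ^ 4` to the distance in the curtain
model.

A shadow gives contraction. Let the ball around `x` with radius `d(x,b)` contain `y`, and let `T`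
be the distance between the projections of `x` and `y` to `b`. An `N`-chain separating these
projections has at most `3N + 9` members. Each of them meets the path from the projection of `x`
through `x` and `y` to the projection of `y`. Two `N`-separated curtains cannot both be long in the
direction of a common geodesic, so that, away from the ends of the chain, at most one member meets
each of the outer segments, and at most one comes much closer to `x` than `d(x,b)`. All others cross
the last part of the segment from `x` to `y`, which has length less than `N + 1`. Hence
`d_L ≤ 3N + 10` for `L ≤ N`, while `d_L ≤ 1 + T` always, so the distance in the curtain model is at
most `2 (3N + 10 + (1 + T) / N)`. With `N` a large multiple of `κ`, half of the shadow `T / κ`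
absorbs the last term, and `T` is at most a multiple of `κ ^ 2`.
-/

/-! ### Geodesics -/

section Geodesic

variable {X : Type*} [MetricSpace X] {γ : ℝ → X} {I : Set ℝ} {x y : X}

theorem IsGeodesicOn.dist_eq_sub (hγ : IsGeodesicOn γ I) {s t : ℝ} (hs : s ∈ I) (ht : t ∈ I)
    (hst : s ≤ t) : dist (γ s) (γ t) = t - s := by
  rw [hγ s hs t ht, abs_sub_comm, abs_of_nonneg (sub_nonneg.2 hst)]

theorem IsGeodesicOn.continuousOn (hγ : IsGeodesicOn γ I) : ContinuousOn γ I := by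
  have : LipschitzOnWith 1 γ I := LipschitzOnWith.of_dist_le_mul fun s hs t ht => by
    rw [hγ s hs t ht, NNReal.coe_one, one_mul, Real.dist_eq]
  exact this.continuousOn

theorem IsGeodesicOn.isSegment (hγ : IsGeodesicOn γ I) (hI : I.OrdConnected) {s t : ℝ}
    (hs : s ∈ I) (ht : t ∈ I) (hst : s ≤ t) : IsSegment (fun u => γ (s + u)) (γ s) (γ t) := by
  have hd : dist (γ s) (γ t) = t - s := hγ.dist_eq_sub hs ht hst
  have hmem : ∀ u ∈ Icc 0 (t - s), s + u ∈ I := fun u hu =>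
    hI.out hs ht ⟨by linarith [hu.1], by linarith [hu.2]⟩
  refine ⟨fun u hu w hw => ?_, by simp, by simp [hd]⟩
  rw [hd] at hu hw
  rw [hγ _ (hmem u hu) _ (hmem w hw), add_sub_add_left_eq_sub]

/-- `a` is a geodesic on the nonempty closed interval `I`, bounded or not: the sets that closest
point projections are taken to. -/
structure IsClosedGeodesic (a : ℝ → X) (I : Set ℝ) : Prop where
  isGeodesicOn : IsGeodesicOn a I
  ordConnected : I.OrdConnected
  isClosed : IsClosed I
  nonempty : I.Nonempty

namespace IsSegment

theorem isClosedGeodesic (h : IsSegment γ x y) : IsClosedGeodesic γ (Icc 0 (dist x y)) :=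
  ⟨h.1, ordConnected_Icc, isClosed_Icc, nonempty_Icc.2 dist_nonneg⟩

theorem dist_left (h : IsSegment γ x y) {s : ℝ} (hs : s ∈ Icc 0 (dist x y)) :
    dist x (γ s) = s := by
  have := h.1.dist_eq_sub (left_mem_Icc.2 dist_nonneg) hs hs.1
  rwa [h.2.1, sub_zero] at this

theorem dist_right (h : IsSegment γ x y) {s : ℝ} (hs : s ∈ Icc 0 (dist x y)) :
    dist (γ s) y = dist x y - s := by
  have := h.1.dist_eq_sub hs (right_mem_Icc.2 dist_nonneg) hs.2
  rwa [h.2.2] at this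

theorem left_mem (h : IsSegment γ x y) : x ∈ γ '' Icc 0 (dist x y) :=
  ⟨0, left_mem_Icc.2 dist_nonneg, h.2.1⟩

theorem right_mem (h : IsSegment γ x y) : y ∈ γ '' Icc 0 (dist x y) :=
  ⟨dist x y, right_mem_Icc.2 dist_nonneg, h.2.2⟩

theorem dist_add_dist (h : IsSegment γ x y) {z : X} (hz : z ∈ γ '' Icc 0 (dist x y)) :
    dist x z + dist z y = dist x y := by
  obtain ⟨s, hs, rfl⟩ := hz
  rw [h.dist_left hs, h.dist_right hs, add_sub_cancel]

theorem isPreconnected (h : IsSegment γ x y) : IsPreconnected (γ '' Icc 0 (dist x y)) :=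
  isPreconnected_Icc.image _ h.1.continuousOn

end IsSegment

end Geodesic

/-! ### Comparison inequalities -/

section Comparison

theorem dist_vec_two (p q r t : ℝ) :
    dist (!₂[p, q] : EuclideanSpace ℝ (Fin 2)) !₂[r, t] = √((p - r) ^ 2 + (q - t) ^ 2) := by
  simp [EuclideanSpace.dist_eq, Fin.sum_univ_two, Real.dist_eq, sq_abs]

theorem exists_comparison_triangle {X : Type*} [PseudoMetricSpace X] (x y z : X) :
    ∃ x' y' z' : EuclideanSpace ℝ (Fin 2),
      dist x' y' = dist x y ∧ dist x' z' = dist x z ∧ dist y' z' = dist y z := by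
  have h₁ : dist x y ≤ dist x z + dist y z := dist_triangle_right x y z
  have h₂ : dist x z ≤ dist x y + dist y z := dist_triangle x y z
  have h₃ : dist y z ≤ dist x y + dist x z := dist_triangle_left y z x
  have ha : 0 ≤ dist x y := dist_nonneg
  have hb : 0 ≤ dist x z := dist_nonneg
  have hc : 0 ≤ dist y z := dist_nonneg
  generalize dist x y = a at *
  generalize dist x z = b at *
  generalize dist y z = c at *
  -- The third vertex has abscissa `(a² + b² - c²) / (2a)` by the law of cosines.
  obtain ⟨u, hu, hub⟩ : ∃ u, 2 * a * u = a ^ 2 + b ^ 2 - c ^ 2 ∧ |u| ≤ b := by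
    rcases ha.eq_or_lt with rfl | ha
    · obtain rfl : b = c := by linarith
      exact ⟨0, by ring, by simpa using hb⟩
    · refine ⟨(a ^ 2 + b ^ 2 - c ^ 2) / (2 * a), by field_simp, ?_⟩
      rw [abs_div, abs_of_pos (by linarith : 0 < 2 * a), div_le_iff₀ (by linarith), abs_le]
      constructor <;> nlinarith
  have hv : √(b ^ 2 - u ^ 2) ^ 2 = b ^ 2 - u ^ 2 :=
    Real.sq_sqrt (sub_nonneg.2 (sq_le_sq' (abs_le.1 hub).1 (abs_le.1 hub).2))
  refine ⟨!₂[0, 0], !₂[a, 0], !₂[u, √(b ^ 2 - u ^ 2)], ?_, ?_, ?_⟩ <;>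
    rw [dist_vec_two]
  · exact (congrArg _ (by ring)).trans (Real.sqrt_sq ha)
  · exact (congrArg _ (by linarith)).trans (Real.sqrt_sq hb)
  · exact (congrArg _ (by linarith)).trans (Real.sqrt_sq hc)

theorem dist_lineMap_sq {V : Type*} [NormedAddCommGroup V] [InnerProductSpace ℝ V] (x y z : V)
    (τ : ℝ) : dist (AffineMap.lineMap x y τ) z ^ 2 =
      (1 - τ) * dist x z ^ 2 + τ * dist y z ^ 2 - τ * (1 - τ) * dist x y ^ 2 := by
  have h₁ : AffineMap.lineMap x y τ - z = (1 - τ) • (x - z) + τ • (y - z) := by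
    rw [AffineMap.lineMap_apply_module]; module
  simp only [dist_eq_norm]
  rw [h₁, ← sub_sub_sub_cancel_right x y z, norm_add_sq_real, norm_sub_sq_real (x - z), norm_smul,
    norm_smul, mul_pow, mul_pow, inner_smul_left, inner_smul_right, Real.norm_eq_abs,
    Real.norm_eq_abs, sq_abs, sq_abs, RCLike.conj_to_real]
  ring

variable {X : Type*} [MetricSpace X]

namespace IsCAT0

theorem stewart (hX : IsCAT0 X) {γ : ℝ → X} {x y : X} (hγ : IsSegment γ x y) (z : X)
    {τ : ℝ} (hτ : τ ∈ Icc (0 : ℝ) 1) :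
    dist (γ (τ * dist x y)) z ^ 2 ≤
      (1 - τ) * dist x z ^ 2 + τ * dist y z ^ 2 - τ * (1 - τ) * dist x y ^ 2 := by
  obtain ⟨x', y', z', hxy, hxz, hyz⟩ := exists_comparison_triangle x y z
  obtain ⟨β, hβ⟩ := hX.exists_segment x z
  have hs : τ * dist x y ∈ Icc 0 (dist x y) :=
    ⟨mul_nonneg hτ.1 dist_nonneg, mul_le_of_le_one_left dist_nonneg hτ.2⟩
  have hx' : dist x' (AffineMap.lineMap x' y' τ) = dist x (γ (τ * dist x y)) := by
    rw [dist_left_lineMap, hγ.dist_left hs, hxy, Real.norm_of_nonneg hτ.1]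
  have hy' : dist (AffineMap.lineMap x' y' τ) y' = dist (γ (τ * dist x y)) y := by
    rw [dist_lineMap_right, hγ.dist_right hs, hxy, Real.norm_of_nonneg (sub_nonneg.2 hτ.2)]
    ring
  rw [← hxy, ← hxz, ← hyz, ← dist_lineMap_sq, hxy]
  gcongr
  exact hX.comparison x y z γ β hγ hβ x' y' z' hxy hxz hyz _ (mem_image_of_mem γ hs) z
    hβ.right_mem _ z' hx' hy' hxz (by rw [dist_self, dist_self])

variable {a : ℝ → X} {I : Set ℝ} {s t τ : ℝ}

theorem stewart_geodesic (hX : IsCAT0 X) (ha : IsGeodesicOn a I) (hI : I.OrdConnected)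
    (hs : s ∈ I) (ht : t ∈ I) (z : X) (hτ : τ ∈ Icc (0 : ℝ) 1) :
    dist (a ((1 - τ) * s + τ * t)) z ^ 2 ≤
      (1 - τ) * dist (a s) z ^ 2 + τ * dist (a t) z ^ 2 - τ * (1 - τ) * (s - t) ^ 2 := by
  wlog hst : s ≤ t generalizing s t τ
  · have := this ht hs (τ := 1 - τ) ⟨by linarith [hτ.2], by linarith [hτ.1]⟩ (le_of_not_ge hst)
    rw [show (1 - (1 - τ)) * t + (1 - τ) * s = (1 - τ) * s + τ * t by ring] at this
    linarith
  have := hX.stewart (ha.isSegment hI hs ht hst) z hτ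
  rw [ha.dist_eq_sub hs ht hst, show s + τ * (t - s) = (1 - τ) * s + τ * t by ring] at this
  linarith

theorem dist_geodesic_le (hX : IsCAT0 X) (ha : IsGeodesicOn a I) (hI : I.OrdConnected)
    (hs : s ∈ I) (ht : t ∈ I) (z : X) (hτ : τ ∈ Icc (0 : ℝ) 1) :
    dist (a ((1 - τ) * s + τ * t)) z ≤ (1 - τ) * dist (a s) z + τ * dist (a t) z := by
  have hstewart := hX.stewart_geodesic ha hI hs ht z hτ
  have hτ' : 0 ≤ 1 - τ := sub_nonneg.2 hτ.2
  have hsub : (dist (a s) z - dist (a t) z) ^ 2 ≤ (s - t) ^ 2 := by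
    rw [sq_le_sq, ← ha s hs t ht]
    exact abs_dist_sub_le _ _ _
  refine le_of_sq_le_sq ?_ (add_nonneg (mul_nonneg hτ' dist_nonneg) (mul_nonneg hτ.1 dist_nonneg))
  nlinarith [mul_le_mul_of_nonneg_left hsub (mul_nonneg hτ.1 hτ')]

/-- Reshetnyak's quadrilateral inequality. -/
theorem quadrilateral (hX : IsCAT0 X) (x₁ x₂ x₃ x₄ : X) :
    dist x₁ x₃ ^ 2 + dist x₂ x₄ ^ 2 ≤
      dist x₁ x₂ ^ 2 + dist x₃ x₄ ^ 2 + 2 * dist x₁ x₄ * dist x₂ x₃ := by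
  rcases (dist_nonneg : 0 ≤ dist x₁ x₄).eq_or_lt with h0 | ha
  · obtain rfl : x₁ = x₄ := dist_eq_zero.1 h0.symm
    rw [dist_self, dist_comm x₃, dist_comm x₂ x₁]
    linarith
  rcases (dist_nonneg : 0 ≤ dist x₂ x₃).eq_or_lt with h0 | hb
  · obtain rfl : x₂ = x₃ := dist_eq_zero.1 h0.symm
    simp
  obtain ⟨γ, hγ⟩ := hX.exists_segment x₂ x₄
  -- The point dividing the diagonal in the ratio of the two sides makes the mixed terms match.
  obtain ⟨τ, hτ0, hτ1, hτab⟩ :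
      ∃ τ, 0 < τ ∧ 0 < 1 - τ ∧ τ * dist x₁ x₄ = (1 - τ) * dist x₂ x₃ := by
    refine ⟨dist x₂ x₃ / (dist x₁ x₄ + dist x₂ x₃), by positivity, ?_, by field_simp; ring⟩
    rw [sub_pos, div_lt_one (by positivity)]
    linarith
  have hτ : τ ∈ Icc (0 : ℝ) 1 := ⟨hτ0.le, by linarith⟩
  have h₁ := mul_le_mul_of_nonneg_left (hX.stewart hγ x₁ hτ) hτ0.le
  have h₃ := mul_le_mul_of_nonneg_left (hX.stewart hγ x₃ hτ) hτ1.le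
  generalize γ (τ * dist x₂ x₄) = m at h₁ h₃
  rw [dist_comm x₂ x₁, dist_comm x₄ x₁] at h₁
  rw [dist_comm x₄ x₃] at h₃
  have htri : dist x₁ x₃ ^ 2 ≤ (dist m x₁ + dist m x₃) ^ 2 := by
    gcongr; exact dist_triangle_left _ _ _
  have hcauchy := sq_nonneg (τ * dist m x₁ - (1 - τ) * dist m x₃)
  have hmixed : τ ^ 2 * dist x₁ x₄ ^ 2 + (1 - τ) ^ 2 * dist x₂ x₃ ^ 2 =
      2 * (τ * (1 - τ)) * (dist x₁ x₄ * dist x₂ x₃) := by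
    linear_combination (τ * dist x₁ x₄ - (1 - τ) * dist x₂ x₃) * hτab
  refine le_of_mul_le_mul_left ?_ (mul_pos hτ0 hτ1)
  linarith [mul_le_mul_of_nonneg_left htri (mul_pos hτ0 hτ1).le]

end IsCAT0

end Comparison

/-! ### Projection to a geodesic -/

section Projection

variable {X : Type*} [MetricSpace X] {a : ℝ → X} {I : Set ℝ} {x y : X}

/-- The parameter of the closest point projection of `x` to the geodesic `a` on `I`; it is
meaningful only if there is a closest point. -/
noncomputable def projParam (a : ℝ → X) (I : Set ℝ) (x : X) : ℝ :=
  Classical.epsilon fun t => t ∈ I ∧ IsClosest (a '' I) x (a t)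

namespace IsClosedGeodesic

theorem exists_isClosest (ha : IsClosedGeodesic a I) (x : X) :
    ∃ t ∈ I, IsClosest (a '' I) x (a t) := by
  obtain ⟨t₀, ht₀⟩ := ha.nonempty
  have hcont : ContinuousOn (fun t => dist x (a t)) I :=
    (continuous_const.dist continuous_id).comp_continuousOn ha.isGeodesicOn.continuousOn
  have hfar : ∀ᶠ t in cocompact ℝ ⊓ 𝓟 I, dist x (a t₀) ≤ dist x (a t) := by
    filter_upwards [mem_inf_of_left ((tendsto_dist_left_cocompact_atTop t₀).eventually_ge_atTop
      (2 * dist x (a t₀))), mem_inf_of_right (mem_principal_self I)] with t ht htI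
    rw [Real.dist_eq, ← ha.isGeodesicOn t₀ ht₀ t htI] at ht
    linarith [dist_triangle_left (a t₀) (a t) x]
  obtain ⟨t, ht, hmin⟩ := hcont.exists_isMinOn' ha.isClosed ht₀ hfar
  exact ⟨t, ht, mem_image_of_mem a ht, forall_mem_image.2 fun s hs => hmin hs⟩

theorem projParam_spec (ha : IsClosedGeodesic a I) (x : X) :
    projParam a I x ∈ I ∧ IsClosest (a '' I) x (a (projParam a I x)) :=
  Classical.epsilon_spec (ha.exists_isClosest x)

theorem projParam_mem (ha : IsClosedGeodesic a I) (x : X) : projParam a I x ∈ I :=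
  (ha.projParam_spec x).1

theorem dist_projParam_le (ha : IsClosedGeodesic a I) (x : X) {t : ℝ} (ht : t ∈ I) :
    dist x (a (projParam a I x)) ≤ dist x (a t) :=
  (ha.projParam_spec x).2.2 _ (mem_image_of_mem a ht)

end IsClosedGeodesic

namespace IsCAT0

theorem pythagoras_of_isClosest (hX : IsCAT0 X) (ha : IsClosedGeodesic a I) {p t : ℝ}
    (hp : p ∈ I) (hc : IsClosest (a '' I) x (a p)) (ht : t ∈ I) :
    dist x (a p) ^ 2 + (t - p) ^ 2 ≤ dist x (a t) ^ 2 := by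
  -- Compare `a p` with the points of the geodesic close to it in Stewart's inequality.
  have hnear : ∀ τ ∈ Ioc (0 : ℝ) 1,
      dist x (a p) ^ 2 + (t - p) ^ 2 - dist x (a t) ^ 2 ≤ τ * (t - p) ^ 2 := by
    intro τ hτ
    have hmem : (1 - τ) * p + τ * t ∈ I :=
      ha.ordConnected.convex hp ht (sub_nonneg.2 hτ.2) hτ.1.le (by ring)
    have hstewart := hX.stewart_geodesic ha.isGeodesicOn ha.ordConnected hp ht x ⟨hτ.1.le, hτ.2⟩
    have hclosest : dist x (a p) ^ 2 ≤ dist (a ((1 - τ) * p + τ * t)) x ^ 2 := by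
      rw [dist_comm _ x]
      gcongr
      exact hc.2 _ (mem_image_of_mem a hmem)
    rw [dist_comm (a p), dist_comm (a t)] at hstewart
    refine le_of_mul_le_mul_left ?_ hτ.1
    nlinarith
  have hlim : Tendsto (fun τ : ℝ => τ * (t - p) ^ 2) (𝓝[>] 0) (𝓝 0) := by
    have : Tendsto (fun τ : ℝ => τ * (t - p) ^ 2) (𝓝 0) (𝓝 (0 * (t - p) ^ 2)) :=
      tendsto_id.mul_const _
    rw [zero_mul] at this
    exact this.mono_left nhdsWithin_le_nhds
  have := ge_of_tendsto hlim (eventually_of_mem (Ioc_mem_nhdsGT one_pos) hnear)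
  linarith

theorem projParam_eq (hX : IsCAT0 X) (ha : IsClosedGeodesic a I) {t : ℝ} (ht : t ∈ I)
    (hc : IsClosest (a '' I) x (a t)) : projParam a I x = t := by
  have hpyth := hX.pythagoras_of_isClosest ha ht hc (ha.projParam_mem x)
  have hle : dist x (a (projParam a I x)) ^ 2 ≤ dist x (a t) ^ 2 := by
    gcongr
    exact ha.dist_projParam_le x ht
  exact sub_eq_zero.1 (pow_eq_zero_iff two_ne_zero |>.1 (by nlinarith))

theorem pythagoras (hX : IsCAT0 X) (ha : IsClosedGeodesic a I) (x : X) {t : ℝ} (ht : t ∈ I) :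
    dist x (a (projParam a I x)) ^ 2 + (t - projParam a I x) ^ 2 ≤ dist x (a t) ^ 2 :=
  hX.pythagoras_of_isClosest ha (ha.projParam_mem x) (ha.projParam_spec x).2 ht

theorem projParam_self (hX : IsCAT0 X) (ha : IsClosedGeodesic a I) {t : ℝ} (ht : t ∈ I) :
    projParam a I (a t) = t :=
  hX.projParam_eq ha ht ⟨mem_image_of_mem a ht, fun q _ => by rw [dist_self]; exact dist_nonneg⟩

theorem abs_projParam_sub_le (hX : IsCAT0 X) (ha : IsClosedGeodesic a I) (x y : X) :
    |projParam a I x - projParam a I y| ≤ dist x y := by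
  have hx := hX.pythagoras ha x (ha.projParam_mem y)
  have hy := hX.pythagoras ha y (ha.projParam_mem x)
  have hquad := hX.quadrilateral x (a (projParam a I x)) (a (projParam a I y)) y
  rw [ha.isGeodesicOn _ (ha.projParam_mem x) _ (ha.projParam_mem y), dist_comm _ y,
    dist_comm _ y] at hquad
  rcases (abs_nonneg (projParam a I x - projParam a I y)).eq_or_lt with h0 | hpos
  · exact h0 ▸ dist_nonneg
  · refine le_of_mul_le_mul_right ?_ hpos
    nlinarith [abs_mul_abs_self (projParam a I x - projParam a I y)]

theorem lipschitzWith_projParam (hX : IsCAT0 X) (ha : IsClosedGeodesic a I) :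
    LipschitzWith 1 (projParam a I) :=
  LipschitzWith.of_dist_le_mul fun x y => by
    rw [NNReal.coe_one, one_mul, Real.dist_eq]
    exact hX.abs_projParam_sub_le ha x y

theorem projParam_eq_of_dist_add (hX : IsCAT0 X) (ha : IsClosedGeodesic a I)
    (hy : dist x y + dist y (a (projParam a I x)) = dist x (a (projParam a I x))) :
    projParam a I y = projParam a I x := by
  refine hX.projParam_eq ha (ha.projParam_mem x)
    ⟨mem_image_of_mem a (ha.projParam_mem x), forall_mem_image.2 fun t ht => ?_⟩
  linarith [ha.dist_projParam_le x ht, dist_triangle x y (a t)]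

theorem projParam_of_mem_segment (hX : IsCAT0 X) (ha : IsClosedGeodesic a I) {γ : ℝ → X}
    (hγ : IsSegment γ x (a (projParam a I x)))
    (hy : y ∈ γ '' Icc 0 (dist x (a (projParam a I x)))) : projParam a I y = projParam a I x :=
  hX.projParam_eq_of_dist_add ha (hγ.dist_add_dist hy)

theorem isPreconnected_projParam_preimage (hX : IsCAT0 X) (ha : IsClosedGeodesic a I)
    {J : Set ℝ} (hJ : J.OrdConnected) : IsPreconnected (projParam a I ⁻¹' J) := by
  rcases (projParam a I ⁻¹' J).eq_empty_or_nonempty with h | ⟨x₀, hx₀⟩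
  · rw [h]; exact isPreconnected_empty
  have hcore : IsPreconnected (a '' (J ∩ I)) :=
    (hJ.inter ha.ordConnected).isPreconnected.image _
      (ha.isGeodesicOn.continuousOn.mono inter_subset_right)
  have hcore_sub : a '' (J ∩ I) ⊆ projParam a I ⁻¹' J :=
    image_subset_iff.2 fun t ht => by
      rw [mem_preimage, mem_preimage, hX.projParam_self ha ht.2]; exact ht.1
  have hfoot : ∀ x, projParam a I x ∈ J → a (projParam a I x) ∈ a '' (J ∩ I) := fun x hx =>
    mem_image_of_mem a ⟨hx, ha.projParam_mem x⟩
  refine isPreconnected_of_forall (a (projParam a I x₀)) fun y hy => ?_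
  obtain ⟨γ, hγ⟩ := hX.exists_segment y (a (projParam a I y))
  refine ⟨_, union_subset hcore_sub fun z hz => ?_, Or.inl (hfoot x₀ hx₀), Or.inr hγ.left_mem,
    hcore.union _ (hfoot y hy) hγ.right_mem hγ.isPreconnected⟩
  rw [mem_preimage, hX.projParam_of_mem_segment ha hγ hz]
  exact hy

theorem mem_projPreimage_iff (hX : IsCAT0 X) (ha : IsClosedGeodesic a I) {J : Set ℝ}
    (hJ : J ⊆ I) : x ∈ projPreimage (a '' I) (a '' J) ↔ projParam a I x ∈ J := by
  constructor
  · rintro ⟨_, ⟨t, ht, rfl⟩, hc⟩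
    rwa [hX.projParam_eq ha (hJ ht) hc]
  · exact fun h => ⟨_, mem_image_of_mem a h, (ha.projParam_spec x).2⟩

end IsCAT0

end Projection

/-! ### Coordinates of curtains -/

namespace Curtain

variable {X : Type*} [MetricSpace X]

section

variable (h : Curtain X)

theorem pole_subset_I : Icc (h.r - 1 / 2) (h.r + 1 / 2) ⊆ h.I :=
  h.pole_subset.trans interior_subset

theorem r_mem_I : h.r ∈ h.I := h.pole_subset_I ⟨by linarith, by linarith⟩

theorem isClosedGeodesic : IsClosedGeodesic h.path h.I :=
  ⟨h.isGeodesicOn, h.ordConnected_I, h.isClosed_I, ⟨h.r, h.r_mem_I⟩⟩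

/-- The signed distance of the projection of `x` from the centre of the pole. The carrier and
the half spaces of a curtain are the preimages of intervals under this function. -/
noncomputable def coord (x : X) : ℝ := projParam h.path h.I x - h.r

/-- `g` is the coordinate of the curtain `h` up to sign, that is, up to the choice of which half
space of `h` is the positive one. -/
def IsOrientation (g : X → ℝ) : Prop := g = h.coord ∨ g = -h.coord

end

variable {h : Curtain X} {g : X → ℝ} {A B : Set X} {x y : X}

theorem isOrientation_coord : h.IsOrientation h.coord := Or.inl rfl

theorem mem_carrier_iff (hX : IsCAT0 X) : x ∈ h.carrier ↔ |h.coord x| ≤ 1 / 2 := by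
  rw [carrier, hX.mem_projPreimage_iff h.isClosedGeodesic h.pole_subset_I, coord, abs_le, mem_Icc]
  constructor <;> rintro ⟨h₁, h₂⟩ <;> constructor <;> linarith

theorem mem_neg_iff (hX : IsCAT0 X) : x ∈ h.neg ↔ h.coord x < -(1 / 2) := by
  rw [neg, hX.mem_projPreimage_iff h.isClosedGeodesic inter_subset_left, coord, mem_inter_iff,
    mem_Iio, and_iff_right (h.isClosedGeodesic.projParam_mem x)]
  constructor <;> intro <;> linarith

theorem mem_pos_iff (hX : IsCAT0 X) : x ∈ h.pos ↔ 1 / 2 < h.coord x := by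
  rw [pos, hX.mem_projPreimage_iff h.isClosedGeodesic inter_subset_left, coord, mem_inter_iff,
    mem_Ioi, and_iff_right (h.isClosedGeodesic.projParam_mem x)]
  constructor <;> intro <;> linarith

namespace IsOrientation

theorem neg (hg : h.IsOrientation g) : h.IsOrientation (-g) := by
  rcases hg with rfl | rfl
  · exact Or.inr rfl
  · exact Or.inl (neg_neg _)

theorem mem_carrier_iff (hg : h.IsOrientation g) (hX : IsCAT0 X) :
    x ∈ h.carrier ↔ |g x| ≤ 1 / 2 := by
  rw [Curtain.mem_carrier_iff hX]
  rcases hg with rfl | rfl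
  · rfl
  · rw [Pi.neg_apply, abs_neg]

theorem abs_sub_le (hg : h.IsOrientation g) (hX : IsCAT0 X) (x y : X) :
    |g x - g y| ≤ dist x y := by
  have hcoord : |h.coord x - h.coord y| ≤ dist x y := by
    rw [coord, coord, sub_sub_sub_cancel_right]
    exact hX.abs_projParam_sub_le h.isClosedGeodesic x y
  rcases hg with rfl | rfl
  · exact hcoord
  · rwa [Pi.neg_apply, Pi.neg_apply, neg_sub_neg, abs_sub_comm]

theorem continuous (hg : h.IsOrientation g) (hX : IsCAT0 X) : Continuous g := by
  have : LipschitzWith 1 g := LipschitzWith.of_dist_le_mul fun x y => by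
    rw [NNReal.coe_one, one_mul, Real.dist_eq]
    exact hg.abs_sub_le hX x y
  exact this.continuous

theorem isPreconnected_preimage (hg : h.IsOrientation g) (hX : IsCAT0 X) {J : Set ℝ}
    (hJ : J.OrdConnected) : IsPreconnected (g ⁻¹' J) := by
  rcases hg with rfl | rfl
  · exact hX.isPreconnected_projParam_preimage h.isClosedGeodesic
      (J := (fun t => t - h.r) ⁻¹' J) (hJ.preimage_mono fun s t hst => sub_le_sub_right hst _)
  · exact hX.isPreconnected_projParam_preimage h.isClosedGeodesic
      (J := (fun t => -(t - h.r)) ⁻¹' J)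
      (hJ.preimage_anti fun s t hst => neg_le_neg (sub_le_sub_right hst _))

theorem separates_iff (hg : h.IsOrientation g) (hX : IsCAT0 X) :
    h.Separates A B ↔ ((∀ x ∈ A, g x < -(1 / 2)) ∧ ∀ x ∈ B, 1 / 2 < g x) ∨
      ((∀ x ∈ A, 1 / 2 < g x) ∧ ∀ x ∈ B, g x < -(1 / 2)) := by
  have hneg : ∀ S : Set X, S ⊆ h.neg ↔ ∀ x ∈ S, h.coord x < -(1 / 2) := fun S =>
    forall₂_congr fun x _ => mem_neg_iff hX
  have hpos : ∀ S : Set X, S ⊆ h.pos ↔ ∀ x ∈ S, 1 / 2 < h.coord x := fun S =>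
    forall₂_congr fun x _ => mem_pos_iff hX
  rw [Separates, hneg, hneg, hpos, hpos]
  rcases hg with rfl | rfl
  · rfl
  · simp only [Pi.neg_apply, neg_lt_neg_iff, lt_neg (a := (1 / 2 : ℝ))]
    exact or_comm

end IsOrientation

theorem Separates.symm (hs : h.Separates A B) : h.Separates B A :=
  (Or.symm hs).imp And.symm And.symm

theorem Separates.exists_orientation (hX : IsCAT0 X) (hs : h.Separates A B) :
    ∃ g, h.IsOrientation g ∧ (∀ x ∈ A, g x < -(1 / 2)) ∧ ∀ x ∈ B, 1 / 2 < g x := by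
  rcases (isOrientation_coord.separates_iff hX).1 hs with hs | hs
  · exact ⟨_, isOrientation_coord, hs⟩
  · exact ⟨_, isOrientation_coord.neg, fun x hx => neg_lt_neg (hs.1 x hx),
      fun x hx => lt_neg_of_lt_neg (hs.2 x hx)⟩

theorem Separates.exists_mem_carrier (hX : IsCAT0 X) (hs : h.Separates {x} {y}) {S : Set X}
    (hS : IsPreconnected S) (hx : x ∈ S) (hy : y ∈ S) : ∃ z ∈ S, z ∈ h.carrier := by
  obtain ⟨g, hg, hgx, hgy⟩ := hs.exists_orientation hX
  have h0 : (0 : ℝ) ∈ Icc (g x) (g y) :=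
    ⟨by linarith [hgx x rfl], by linarith [hgy y rfl]⟩
  obtain ⟨z, hz, hgz⟩ := hS.intermediate_value hx hy (hg.continuous hX).continuousOn h0
  exact ⟨z, hz, (hg.mem_carrier_iff hX).2 (by rw [hgz]; norm_num)⟩

theorem isPreconnected_carrier (hX : IsCAT0 X) : IsPreconnected h.carrier := by
  have : h.carrier = h.coord ⁻¹' Icc (-(1 / 2)) (1 / 2) := by
    ext x
    rw [mem_carrier_iff hX, abs_le, mem_preimage, mem_Icc]
  rw [this]
  exact isOrientation_coord.isPreconnected_preimage hX ordConnected_Icc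

theorem carrier_nonempty (hX : IsCAT0 X) : h.carrier.Nonempty :=
  ⟨h.path h.r, by
    rw [mem_carrier_iff hX, coord, hX.projParam_self h.isClosedGeodesic h.r_mem_I]; norm_num⟩

theorem exists_orientation_of_disjoint (hX : IsCAT0 X) {k : Curtain X}
    (hd : Disjoint h.carrier k.carrier) :
    ∃ g, h.IsOrientation g ∧ ∀ x ∈ k.carrier, 1 / 2 < g x := by
  obtain ⟨w, hw⟩ := k.carrier_nonempty hX
  obtain ⟨g, hg, hgw⟩ : ∃ g, h.IsOrientation g ∧ 1 / 2 < g w := by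
    have hout : 1 / 2 < |h.coord w| := by
      rw [← not_le, ← mem_carrier_iff hX]
      exact fun hw' => disjoint_left.1 hd hw' hw
    rcases lt_abs.1 hout with hpos | hneg
    · exact ⟨_, isOrientation_coord, hpos⟩
    · exact ⟨_, isOrientation_coord.neg, hneg⟩
  refine ⟨g, hg, fun x hx => ?_⟩
  by_contra! hle
  obtain ⟨y, hy, hgy⟩ := (k.isPreconnected_carrier hX).intermediate_value hx hw
    (hg.continuous hX).continuousOn ⟨hle, hgw.le⟩
  exact disjoint_left.1 hd ((hg.mem_carrier_iff hX).2 (by rw [hgy]; norm_num)) hy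

end Curtain

/-! ### Chains of curtains -/

section Chains

variable {X : Type*} [MetricSpace X]

/-- The points in or before the curtain with oriented coordinate `g` lie before the curtain with
oriented coordinate `g'`. -/
def Precedes (g g' : X → ℝ) : Prop := ∀ x, g x ≤ 1 / 2 → g' x < -(1 / 2)

instance : IsTrans (X → ℝ) Precedes :=
  ⟨fun _ _ _ h h' x hx => h' x (by linarith [h x hx])⟩

theorem Curtain.IsOrientation.precedes (hX : IsCAT0 X) {h k : Curtain X} {g g' : X → ℝ}
    (hg : h.IsOrientation g) (hg' : k.IsOrientation g') (hk : ∀ x ∈ k.carrier, 1 / 2 < g x)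
    (hh : ∀ x ∈ h.carrier, g' x < -(1 / 2)) : Precedes g g' := by
  intro x hx
  by_contra! hle
  obtain ⟨w, hw⟩ := h.carrier_nonempty hX
  obtain ⟨y, hy, hgy⟩ := (hg.isPreconnected_preimage hX ordConnected_Iic).intermediate_value
    (mem_Iic.2 (abs_le.1 ((hg.mem_carrier_iff hX).1 hw)).2) (mem_Iic.2 hx)
    (hg'.continuous hX).continuousOn ⟨(hh w hw).le, hle⟩
  have hyk : y ∈ k.carrier := (hg'.mem_carrier_iff hX).2 (by rw [hgy]; norm_num)
  exact absurd (hk y hyk) (not_lt.2 hy)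

variable {n : ℕ} {c : Fin n → Curtain X} {g : Fin n → X → ℝ} {x y z w : X}

/-- `g` orients the members of `c` coherently: their lower half spaces are nested. -/
structure IsNestedOrientation (c : Fin n → Curtain X) (g : Fin n → X → ℝ) : Prop where
  isOrientation : ∀ i, (c i).IsOrientation (g i)
  precedes : ∀ ⦃i j⦄, i < j → Precedes (g i) (g j)

namespace IsChainOfCurtains

theorem exists_orientation_member (hX : IsCAT0 X) (hc : IsChainOfCurtains c) (j : Fin n) :
    ∃ g, (c j).IsOrientation g ∧
      (∀ i : Fin n, (i : ℕ) + 1 = j → ∀ x ∈ (c i).carrier, g x < -(1 / 2)) ∧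
      ∀ k : Fin n, (j : ℕ) + 1 = k → ∀ x ∈ (c k).carrier, 1 / 2 < g x := by
  by_cases hpred : ∃ i : Fin n, (i : ℕ) + 1 = j <;> by_cases hsucc : ∃ k : Fin n, (j : ℕ) + 1 = k
  · obtain ⟨⟨i, hi⟩, ⟨k, hk⟩⟩ := hpred, hsucc
    obtain ⟨g, hg, hgi, hgk⟩ := (hc.2 i j k hi hk).exists_orientation hX
    refine ⟨g, hg, fun i' hi' => ?_, fun k' hk' => ?_⟩
    · obtain rfl : i' = i := Fin.ext (by omega)
      exact hgi
    · obtain rfl : k' = k := Fin.ext (by omega)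
      exact hgk
  · obtain ⟨i, hi⟩ := hpred
    obtain ⟨g, hg, hgi⟩ := Curtain.exists_orientation_of_disjoint hX
      (hc.1 j i (by rintro rfl; omega))
    refine ⟨_, hg.neg, fun i' hi' x hx => ?_, fun k hk => (hsucc ⟨k, hk⟩).elim⟩
    obtain rfl : i' = i := Fin.ext (by omega)
    exact neg_lt_neg (hgi x hx)
  · obtain ⟨k, hk⟩ := hsucc
    obtain ⟨g, hg, hgk⟩ := Curtain.exists_orientation_of_disjoint hX
      (hc.1 j k (by rintro rfl; omega))
    refine ⟨_, hg, fun i hi => (hpred ⟨i, hi⟩).elim, fun k' hk' => ?_⟩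
    obtain rfl : k' = k := Fin.ext (by omega)
    exact hgk
  · exact ⟨_, Curtain.isOrientation_coord, fun i hi => (hpred ⟨i, hi⟩).elim,
      fun k hk => (hsucc ⟨k, hk⟩).elim⟩

theorem exists_isNestedOrientation (hX : IsCAT0 X) (hc : IsChainOfCurtains c) :
    ∃ g, IsNestedOrientation c g := by
  choose g hg hpred hsucc using hc.exists_orientation_member hX
  refine ⟨g, hg, ?_⟩
  rcases n with _ | n
  · exact fun i => i.elim0
  · refine (Fin.liftFun_iff_succ Precedes).2 fun i => ?_
    exact (hg _).precedes hX (hg _) (hsucc _ i.succ (by simp)) (hpred i.succ _ (by simp))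

end IsChainOfCurtains

namespace IsNestedOrientation

theorem sub_add_one_le_dist (hX : IsCAT0 X) (hg : IsNestedOrientation c g) {i j : Fin n}
    (hij : i ≤ j) (hx : g i x ≤ -(1 / 2)) (hy : 1 / 2 ≤ g j y) :
    (j : ℝ) - i + 1 ≤ dist x y := by
  obtain ⟨m, hm⟩ := Nat.exists_eq_add_of_le (Fin.le_def.1 hij)
  induction m generalizing j y with
  | zero =>
    obtain rfl : j = i := Fin.ext hm
    linarith [(abs_le.1 ((hg.isOrientation j).abs_sub_le hX x y)).1]
  | succ m ih =>
    -- On the way from `x` to `y`, stop on entering the last curtain.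
    have hlt : i < j := Fin.lt_def.2 (by omega)
    obtain ⟨γ, hγ⟩ := hX.exists_segment x y
    obtain ⟨z, hz, hgz⟩ := hγ.isPreconnected.intermediate_value hγ.left_mem hγ.right_mem
      ((hg.isOrientation j).continuous hX).continuousOn
      (⟨(hg.precedes hlt x (by linarith)).le, by linarith⟩ : -(1 / 2) ∈ Icc (g j x) (g j y))
    obtain ⟨k, hk⟩ : ∃ k : Fin n, (k : ℕ) = i + m := ⟨⟨i + m, by omega⟩, rfl⟩
    have hzk : 1 / 2 ≤ g k z := by
      by_contra! hle
      linarith [hg.precedes (Fin.lt_def.2 (by omega) : k < j) z hle.le]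
    have hxz := ih (Fin.le_def.2 (by omega)) hzk hk
    have hzy := (abs_le.1 ((hg.isOrientation j).abs_sub_le hX z y)).1
    rw [hk] at hxz
    rw [hm]
    push_cast at hxz ⊢
    linarith [hγ.dist_add_dist hz]

theorem sub_le_dist_carrier (hX : IsCAT0 X) (hg : IsNestedOrientation c g) {i j : Fin n}
    (hij : i ≤ j) (hx : g i x ≤ -(1 / 2)) (hw : w ∈ (c j).carrier) :
    (j : ℝ) - i ≤ dist x w := by
  rcases hij.eq_or_lt with rfl | hij
  · rw [sub_self]; exact dist_nonneg
  obtain ⟨k, hk, hik⟩ : ∃ k : Fin n, (k : ℕ) + 1 = j ∧ i ≤ k := by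
    rw [Fin.lt_def] at hij
    exact ⟨⟨j - 1, by omega⟩, Nat.sub_add_cancel (by omega), Fin.le_def.2 (Nat.le_pred_of_lt hij)⟩
  have hwk : 1 / 2 ≤ g k w := by
    by_contra! hle
    linarith [hg.precedes (Fin.lt_def.2 (by omega) : k < j) w hle.le,
      (abs_le.1 (((hg.isOrientation j).mem_carrier_iff hX).1 hw)).1]
  have := hg.sub_add_one_le_dist hX hik hx hwk
  rw [← hk]
  push_cast
  linarith

theorem exists_le_neg_half_of_mem_carrier (hX : IsCAT0 X) (hg : IsNestedOrientation c g)
    {i j : Fin n} (hij : i < j) (hz : z ∈ (c i).carrier) :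
    ∃ k : Fin n, (k : ℕ) = i + 1 ∧ k ≤ j ∧ g k z ≤ -(1 / 2) := by
  rw [Fin.lt_def] at hij
  refine ⟨⟨i + 1, by omega⟩, rfl, Fin.le_def.2 hij, ?_⟩
  exact (hg.precedes (Fin.lt_def.2 i.1.lt_succ_self) z
    (abs_le.1 (((hg.isOrientation i).mem_carrier_iff hX).1 hz)).2).le

theorem sub_le_carrier_dist (hX : IsCAT0 X) (hg : IsNestedOrientation c g) {i j : Fin n}
    (hij : i ≤ j) (hz : z ∈ (c i).carrier) (hy : 1 / 2 ≤ g j y) : (j : ℝ) - i ≤ dist z y := by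
  rcases hij.eq_or_lt with rfl | hij
  · rw [sub_self]; exact dist_nonneg
  obtain ⟨k, hk, hkj, hkz⟩ := hg.exists_le_neg_half_of_mem_carrier hX hij hz
  have := hg.sub_add_one_le_dist hX hkj hkz hy
  rw [hk] at this
  push_cast at this
  linarith

theorem sub_sub_one_le_dist (hX : IsCAT0 X) (hg : IsNestedOrientation c g) {i j : Fin n}
    (hij : i < j) (hz : z ∈ (c i).carrier) (hw : w ∈ (c j).carrier) :
    (j : ℝ) - i - 1 ≤ dist z w := by
  obtain ⟨k, hk, hkj, hkz⟩ := hg.exists_le_neg_half_of_mem_carrier hX hij hz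
  have := hg.sub_le_dist_carrier hX hkj hkz hw
  rw [hk] at this
  push_cast at this
  linarith

theorem forall_or_forall_of_separates (hX : IsCAT0 X) (hg : IsNestedOrientation c g)
    (hs : ∀ i, (c i).Separates {x} {y}) :
    (∀ i, g i x < -(1 / 2) ∧ 1 / 2 < g i y) ∨ ∀ i, 1 / 2 < g i x ∧ g i y < -(1 / 2) := by
  have hside : ∀ i, (g i x < -(1 / 2) ∧ 1 / 2 < g i y) ∨ (1 / 2 < g i x ∧ g i y < -(1 / 2)) :=
    fun i => by
      simpa only [mem_singleton_iff, forall_eq] using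
        ((hg.isOrientation i).separates_iff hX).1 (hs i)
  rcases n with _ | n
  · exact Or.inl fun i => i.elim0
  have hzero : ∀ {u : X}, g 0 u < -(1 / 2) → ∀ i, g i u < -(1 / 2) := fun hu i =>
    (Fin.zero_le i).eq_or_lt.elim (fun h => h ▸ hu) fun h => hg.precedes h _ (by linarith)
  rcases hside 0 with ⟨hx, -⟩ | ⟨-, hy⟩
  · exact Or.inl fun i => (hside i).resolve_right fun h => by linarith [hzero hx i]
  · exact Or.inr fun i => (hside i).resolve_left fun h => by linarith [hzero hy i]

end IsNestedOrientation

namespace IsChainOfCurtains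

theorem card_le_dist (hX : IsCAT0 X) (hc : IsChainOfCurtains c)
    (hs : ∀ i, (c i).Separates {x} {y}) : (n : ℝ) ≤ dist x y := by
  obtain ⟨g, hg⟩ := hc.exists_isNestedOrientation hX
  rcases n with _ | n
  · simp
  rcases hg.forall_or_forall_of_separates hX hs with h | h
  · simpa using hg.sub_add_one_le_dist hX (Fin.zero_le (Fin.last n)) (h 0).1.le (h _).2.le
  · simpa [dist_comm] using
      hg.sub_add_one_le_dist hX (Fin.zero_le (Fin.last n)) (h 0).2.le (h _).1.le

theorem le_dist_of_separates (hX : IsCAT0 X) (hc : IsChainOfCurtains c)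
    (hs : ∀ i, (c i).Separates {x} {y}) {i : Fin n} {m : ℕ} (hmi : m ≤ (i : ℕ))
    (him : (i : ℕ) + m < n) (hz : z ∈ (c i).carrier) : (m : ℝ) ≤ dist x z := by
  obtain ⟨g, hg⟩ := hc.exists_isNestedOrientation hX
  rcases n with _ | n
  · exact i.elim0
  rcases hg.forall_or_forall_of_separates hX hs with h | h
  · have hm : (m : ℝ) ≤ i := by exact_mod_cast hmi
    have := hg.sub_le_dist_carrier hX (Fin.zero_le i) (h 0).1.le hz
    rw [Fin.val_zero, Nat.cast_zero] at this
    linarith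
  · have hm : (i : ℝ) + m ≤ n := by exact_mod_cast Nat.le_of_lt_succ him
    have := hg.sub_le_carrier_dist hX (Fin.le_last i) hz (h _).1.le
    rw [Fin.val_last, dist_comm] at this
    linarith

end IsChainOfCurtains

end Chains

/-! ### Separated curtains crossing a geodesic -/

section DualChains

variable {X : Type*} [MetricSpace X]

theorem isChainOfCurtains_of_coord (hX : IsCAT0 X) {n : ℕ} {c : Fin n → Curtain X} {f : X → ℝ}
    {r : Fin n → ℝ} (hc : ∀ i x, (c i).coord x = f x - r i)
    (hr : ∀ ⦃i j⦄, i < j → r i + 1 < r j) : IsChainOfCurtains c := by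
  have hbefore : ∀ ⦃i j⦄, i < j → ∀ x ∈ (c i).carrier, (c j).coord x < -(1 / 2) := by
    intro i j hij x hx
    have := (abs_le.1 ((Curtain.mem_carrier_iff hX).1 hx)).2
    rw [hc] at this ⊢
    linarith [hr hij]
  have hafter : ∀ ⦃i j⦄, i < j → ∀ x ∈ (c j).carrier, 1 / 2 < (c i).coord x := by
    intro i j hij x hx
    have := (abs_le.1 ((Curtain.mem_carrier_iff hX).1 hx)).1
    rw [hc] at this ⊢
    linarith [hr hij]
  refine ⟨fun i j hij => disjoint_left.2 fun x hxi hxj => ?_, fun i j k hij hjk => ?_⟩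
  · have hx := abs_le.1 ((Curtain.mem_carrier_iff hX).1 hxj)
    rcases hij.lt_or_gt with h | h
    · linarith [hbefore h x hxi]
    · linarith [hafter h x hxi]
  · exact (Curtain.isOrientation_coord.separates_iff hX).2
      (Or.inl ⟨hbefore (Fin.lt_def.2 (by omega)), hafter (Fin.lt_def.2 (by omega))⟩)

variable {a : ℝ → X} {I : Set ℝ}

theorem IsCAT0.exists_dual_curtains (hX : IsCAT0 X) (ha : IsClosedGeodesic a I) {u M : ℝ}
    (hM : 1 < M) {n : ℕ} (hI : Ioo u (u + M * n) ⊆ I) :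
    ∃ c : Fin n → Curtain X, IsChainOfCurtains c ∧
      ∀ (j : Fin n) (x : X), (c j).coord x = projParam a I x - (u + M * (j + 1 / 2)) := by
  have hpole : ∀ j : Fin n, Icc (u + M * (j + 1 / 2) - 1 / 2) (u + M * (j + 1 / 2) + 1 / 2) ⊆
      interior I := fun j => by
    have hj : (j : ℝ) + 1 ≤ n := by exact_mod_cast j.2
    refine fun t ht => interior_maximal hI isOpen_Ioo ⟨?_, ?_⟩
    · have : 0 ≤ M * (j : ℕ) := by positivity
      linarith [ht.1]
    · have := mul_le_mul_of_nonneg_left hj (by linarith : 0 ≤ M)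
      linarith [ht.2]
  refine ⟨fun j => ⟨I, ha.isClosed, ha.ordConnected, a, ha.isGeodesicOn, _, hpole j⟩,
    isChainOfCurtains_of_coord hX (f := projParam a I) (r := fun j => u + M * (j + 1 / 2))
      (fun _ _ => rfl) fun i j hij => ?_, fun _ _ => rfl⟩
  have hij : (i : ℝ) + 1 ≤ j := by exact_mod_cast hij
  have := mul_le_mul_of_nonneg_left hij (by linarith : 0 ≤ M)
  linarith

theorem IsLSeparated.symm {L : ℕ} {h k : Curtain X} (hhk : IsLSeparated L h k) :
    IsLSeparated L k h :=
  ⟨hhk.1.symm, fun n c hc hm => hhk.2 n c hc fun i => (hm i).symm⟩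

/-- Otherwise the two curtains would both be crossed by a chain of `N + 1` curtains dual to the
geodesic. -/
theorem IsLSeparated.sub_le (hX : IsCAT0 X) (ha : IsClosedGeodesic a I) {N : ℕ}
    {h k : Curtain X} (hhk : IsLSeparated N h k) {r s : ℝ} {x y x' y' : X}
    (hx : x ∈ h.carrier) (hy : y ∈ h.carrier) (hx' : x' ∈ k.carrier) (hy' : y' ∈ k.carrier)
    (hxr : projParam a I x ≤ r) (hys : s ≤ projParam a I y)
    (hxr' : projParam a I x' ≤ r) (hys' : s ≤ projParam a I y') : s - r ≤ N + 1 := by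
  by_contra! hlt
  obtain ⟨M, hM, hMN⟩ : ∃ M : ℝ, 1 < M ∧ M * ((N + 1 : ℕ) : ℝ) = s - r := by
    push_cast
    exact ⟨(s - r) / (N + 1), by rw [lt_div_iff₀ (by positivity)]; linarith, by field_simp⟩
  have hI : Ioo r (r + M * (N + 1 : ℕ)) ⊆ I := fun t ht => by
    rw [hMN] at ht
    exact ha.ordConnected.out (ha.projParam_mem x) (ha.projParam_mem y)
      ⟨by linarith [ht.1], by linarith [ht.2]⟩
  obtain ⟨c, hc, hcoord⟩ := hX.exists_dual_curtains ha hM hI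
  have hmeets : ∀ {l : Curtain X} {v w : X}, v ∈ l.carrier → w ∈ l.carrier →
      projParam a I v ≤ r → s ≤ projParam a I w → ∀ i, (c i).Meets l := by
    intro l v w hv hw hvr hws i
    have hi : ((i : ℕ) : ℝ) + 1 ≤ (N + 1 : ℕ) := by exact_mod_cast i.2
    have hlow : (0 : ℝ) ≤ M * (i : ℕ) := by positivity
    have hhigh := mul_le_mul_of_nonneg_left hi (by linarith : 0 ≤ M)
    have h0 : (0 : ℝ) ∈ Icc ((c i).coord v) ((c i).coord w) := by
      rw [hcoord, hcoord]
      constructor <;> linarith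
    obtain ⟨z, hz, hcz⟩ := (l.isPreconnected_carrier hX).intermediate_value hv hw
      (Curtain.isOrientation_coord.continuous hX).continuousOn h0
    exact ⟨z, (Curtain.mem_carrier_iff hX).2 (by rw [hcz]; norm_num), hz⟩
  have := hhk.2 (N + 1) c hc fun i => ⟨hmeets hx hy hxr hys i, hmeets hx' hy' hxr' hys' i⟩
  omega

end DualChains

/-! ### Long chains have close projections -/

section LongChains

theorem card_le_sum_of_forall_exists {ι : Type*} [Fintype ι] {n : ℕ} {P : ι → Fin n → Prop}
    {m : ι → ℕ} (hcover : ∀ i, ∃ l, P l i)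
    (hP : ∀ l ⦃i j⦄, P l i → P l j → (i : ℕ) < j + m l) : n ≤ ∑ l, m l := by
  classical
  choose l hl using hcover
  have hfibre : ∀ k, (Finset.univ.filter fun i => l i = k).card ≤ m k := by
    intro k
    set S := Finset.univ.filter fun i => l i = k
    have hPS : ∀ i ∈ S, P k i := fun i hi => (Finset.mem_filter.1 hi).2 ▸ hl i
    rcases S.eq_empty_or_nonempty with h0 | hne
    · simp [h0]
    calc S.card = (S.image Fin.val).card :=
        (Finset.card_image_of_injective S Fin.val_injective).symm
      _ ≤ (Finset.Ico (S.min' hne : ℕ) (S.min' hne + m k)).card :=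
        Finset.card_le_card <| Finset.image_subset_iff.2 fun i hi => Finset.mem_Ico.2
          ⟨Fin.le_def.1 (S.min'_le i hi), hP k (hPS i hi) (hPS _ (S.min'_mem hne))⟩
      _ = m k := by rw [Nat.card_Ico, Nat.add_sub_cancel_left]
  calc n = (Finset.univ : Finset (Fin n)).card := by rw [Finset.card_univ, Fintype.card_fin]
    _ = ∑ k, (Finset.univ.filter fun i => l i = k).card :=
      Finset.card_eq_sum_card_fiberwise fun i _ => Finset.mem_coe.2 (Finset.mem_univ _)
    _ ≤ ∑ k, m k := Finset.sum_le_sum fun k _ => hfibre k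

variable {X : Type*} [MetricSpace X] {a : ℝ → X} {I : Set ℝ} {N n : ℕ} {h k : Curtain X}
  {c : Fin n → Curtain X} {p q u u' : ℝ} {v v' x y z z' : X}

theorem IsClosedGeodesic.exists_mem_carrier (ha : IsClosedGeodesic a I) (hX : IsCAT0 X)
    (hp : p ∈ I) (hq : q ∈ I) (hs : h.Separates {a p} {a q}) :
    ∃ u ∈ uIcc p q, a u ∈ h.carrier := by
  obtain ⟨_, ⟨u, hu, rfl⟩, hc⟩ := hs.exists_mem_carrier hX (isPreconnected_uIcc.image a
    (ha.isGeodesicOn.continuousOn.mono (ha.ordConnected.uIcc_subset hp hq)))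
    (mem_image_of_mem a left_mem_uIcc) (mem_image_of_mem a right_mem_uIcc)
  exact ⟨u, hu, hc⟩

namespace IsLSeparated

theorem abs_sub_le_or_abs_sub_le (hX : IsCAT0 X) (ha : IsClosedGeodesic a I)
    (hhk : IsLSeparated N h k) (hz : z ∈ h.carrier) (hz' : z' ∈ k.carrier)
    (hzp : projParam a I z = p) (hzp' : projParam a I z' = p) (huI : u ∈ I) (huI' : u' ∈ I)
    (hu : u ∈ uIcc p q) (hu' : u' ∈ uIcc p q) (huh : a u ∈ h.carrier) (huk : a u' ∈ k.carrier) :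
    |u - p| ≤ N + 1 ∨ |u' - p| ≤ N + 1 := by
  have hproj := hX.projParam_self ha huI
  have hproj' := hX.projParam_self ha huI'
  rcases le_total p q with hpq | hpq
  · rw [uIcc_of_le hpq] at hu hu'
    have := hhk.sub_le hX ha (s := min u u') hz huh hz' huk hzp.le
      ((min_le_left _ _).trans_eq hproj.symm) hzp'.le ((min_le_right _ _).trans_eq hproj'.symm)
    rw [abs_of_nonneg (sub_nonneg.2 hu.1), abs_of_nonneg (sub_nonneg.2 hu'.1)]
    rwa [← min_sub_sub_right, min_le_iff] at this
  · rw [uIcc_of_ge hpq] at hu hu'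
    have := hhk.sub_le hX ha (r := max u u') huh hz huk hz' (hproj.trans_le (le_max_left _ _))
      hzp.ge (hproj'.trans_le (le_max_right _ _)) hzp'.ge
    rw [abs_sub_comm, abs_of_nonneg (sub_nonneg.2 hu.2), abs_sub_comm,
      abs_of_nonneg (sub_nonneg.2 hu'.2)]
    rwa [← min_sub_sub_left, min_le_iff] at this

end IsLSeparated

/-- Seen from `x`, the geodesic `a` lies behind its point closest to `x`. -/
theorem IsCAT0.projParam_segment_eq (hX : IsCAT0 X) (ha : IsClosedGeodesic a I) {e : ℝ → X}
    (he : IsSegment e x (a (projParam a I x))) (hu : u ∈ I) :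
    projParam e (Icc 0 (dist x (a (projParam a I x)))) (a u) =
      dist x (a (projParam a I x)) := by
  refine hX.projParam_eq he.isClosedGeodesic (right_mem_Icc.2 dist_nonneg)
    ⟨by rw [he.2.2]; exact he.right_mem, fun z hz => ?_⟩
  rw [he.2.2, ha.isGeodesicOn _ hu _ (ha.projParam_mem x)]
  have := hX.abs_projParam_sub_le ha (a u) z
  rwa [hX.projParam_self ha hu, hX.projParam_of_mem_segment ha he hz] at this

theorem IsLSeparated.dist_le_max_add (hX : IsCAT0 X) (ha : IsClosedGeodesic a I)
    (hhk : IsLSeparated N h k) (hv : v ∈ h.carrier) (hv' : v' ∈ k.carrier) (hu : u ∈ I)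
    (hu' : u' ∈ I) (huh : a u ∈ h.carrier) (huk : a u' ∈ k.carrier) :
    dist x (a (projParam a I x)) ≤ max (dist x v) (dist x v') + (N + 1) := by
  obtain ⟨e, he⟩ := hX.exists_segment x (a (projParam a I x))
  have hxe : projParam e (Icc 0 (dist x (a (projParam a I x)))) x = 0 := by
    have := hX.projParam_self he.isClosedGeodesic (left_mem_Icc.2 dist_nonneg)
    rwa [he.2.1] at this
  have hle : ∀ w, projParam e (Icc 0 (dist x (a (projParam a I x)))) w ≤ dist x w := fun w => by
    have := hX.abs_projParam_sub_le he.isClosedGeodesic w x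
    rw [hxe, sub_zero, dist_comm w] at this
    exact (le_abs_self _).trans this
  have := hhk.sub_le hX he.isClosedGeodesic hv huh hv' huk
    ((hle v).trans (le_max_left _ (dist x v'))) (hX.projParam_segment_eq ha he hu).ge
    ((hle v').trans (le_max_right _ _)) (hX.projParam_segment_eq ha he hu').ge
  linarith

namespace IsLChain

/-- Far from the ends of the chain, at most one member reaches the fibre over `p`. -/
theorem eq_of_projParam_eq (hX : IsCAT0 X) (ha : IsClosedGeodesic a I) (hc : IsLChain N c)
    (hp : p ∈ I) (hq : q ∈ I) (hs : ∀ i, (c i).Separates {a p} {a q}) {i j : Fin n}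
    (hi : (N + 2 ≤ (i : ℕ) ∧ (i : ℕ) + (N + 2) < n) ∧ ∃ z ∈ (c i).carrier, projParam a I z = p)
    (hj : (N + 2 ≤ (j : ℕ) ∧ (j : ℕ) + (N + 2) < n) ∧ ∃ z ∈ (c j).carrier, projParam a I z = p) :
    i = j := by
  have hfar : ∀ l : Fin n, N + 2 ≤ (l : ℕ) → (l : ℕ) + (N + 2) < n →
      ∃ u ∈ uIcc p q, a u ∈ (c l).carrier ∧ (N : ℝ) + 1 < |u - p| := by
    intro l hl hl'
    obtain ⟨u, hu, huc⟩ := ha.exists_mem_carrier hX hp hq (hs l)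
    have hdist := hc.1.le_dist_of_separates hX hs hl hl' huc
    rw [ha.isGeodesicOn _ hp _ (ha.ordConnected.uIcc_subset hp hq hu), abs_sub_comm] at hdist
    push_cast at hdist
    exact ⟨u, hu, huc, by linarith⟩
  by_contra hij
  obtain ⟨hi, z, hz, hzp⟩ := hi
  obtain ⟨hj, z', hz', hzp'⟩ := hj
  obtain ⟨u, hu, huc, hup⟩ := hfar i hi.1 hi.2
  obtain ⟨u', hu', huc', hup'⟩ := hfar j hj.1 hj.2
  have hI := ha.ordConnected.uIcc_subset hp hq
  rcases (hc.2 i j hij).abs_sub_le_or_abs_sub_le hX ha hz hz' hzp hzp' (hI hu) (hI hu') hu hu'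
    huc huc' with hle | hle <;> linarith

/-- Curtains that meet the geodesic and come close to `x` all cross the segment from `x` to its
projection. -/
theorem eq_of_dist_lt (hX : IsCAT0 X) (ha : IsClosedGeodesic a I) (hc : IsLChain N c)
    (hp : p ∈ I) (hq : q ∈ I) (hs : ∀ i, (c i).Separates {a p} {a q}) {i j : Fin n}
    (hi : ∃ z ∈ (c i).carrier, dist x z < dist x (a (projParam a I x)) - (N + 1))
    (hj : ∃ z ∈ (c j).carrier, dist x z < dist x (a (projParam a I x)) - (N + 1)) : i = j := by
  by_contra hij
  obtain ⟨z, hz, hxz⟩ := hi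
  obtain ⟨z', hz', hxz'⟩ := hj
  obtain ⟨u, hu, huc⟩ := ha.exists_mem_carrier hX hp hq (hs i)
  obtain ⟨u', hu', huc'⟩ := ha.exists_mem_carrier hX hp hq (hs j)
  have hI := ha.ordConnected.uIcc_subset hp hq
  linarith [(hc.2 i j hij).dist_le_max_add (x := x) hX ha hz hz' (hI hu) (hI hu') huc huc',
    max_lt hxz hxz']

end IsLChain

theorem IsSegment.dist_lt_of_lt {α : ℝ → X} (hα : IsSegment α x y)
    (hz : z ∈ α '' Icc 0 (dist x y)) (hz' : z' ∈ α '' Icc 0 (dist x y)) {r s : ℝ}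
    (hxz : r - s ≤ dist x z) (hxz' : r - s ≤ dist x z') (hxy : dist x y < r) :
    dist z z' < s := by
  obtain ⟨t, ht, rfl⟩ := hz
  obtain ⟨t', ht', rfl⟩ := hz'
  rw [hα.dist_left ht] at hxz
  rw [hα.dist_left ht'] at hxz'
  rw [hα.1 t ht t' ht', abs_lt]
  constructor <;> linarith [ht.2, ht'.2]

theorem IsChainOfCurtains.lt_add_of_dist_lt (hX : IsCAT0 X) (hc : IsChainOfCurtains c)
    {i j : Fin n} {m : ℕ} (hz : z ∈ (c i).carrier) (hz' : z' ∈ (c j).carrier)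
    (hd : dist z z' < m) : (i : ℕ) < j + (m + 1) := by
  obtain ⟨g, hg⟩ := hc.exists_isNestedOrientation hX
  by_contra! hle
  have := hg.sub_sub_one_le_dist hX (Fin.lt_def.2 (by omega) : j < i) hz' hz
  rw [dist_comm] at this
  have hle' : (j : ℝ) + (m + 1) ≤ i := by exact_mod_cast hle
  linarith

theorem Curtain.Separates.exists_mem_carrier_of_projParam (hX : IsCAT0 X)
    (ha : IsClosedGeodesic a I) {α : ℝ → X} (hα : IsSegment α x y)
    (hs : h.Separates {a (projParam a I x)} {a (projParam a I y)}) :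
    (∃ z ∈ h.carrier, projParam a I z = projParam a I x) ∨
      (∃ z ∈ α '' Icc 0 (dist x y), z ∈ h.carrier) ∨
      ∃ z ∈ h.carrier, projParam a I z = projParam a I y := by
  obtain ⟨e, he⟩ := hX.exists_segment x (a (projParam a I x))
  obtain ⟨f, hf⟩ := hX.exists_segment y (a (projParam a I y))
  have hpath := he.isPreconnected.union x he.left_mem (Or.inl hα.left_mem)
    (hα.isPreconnected.union y hα.right_mem hf.left_mem hf.isPreconnected)
  obtain ⟨z, hz | hz | hz, hzh⟩ :=
    hs.exists_mem_carrier hX hpath (Or.inl he.right_mem) (Or.inr (Or.inr hf.right_mem))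
  · exact Or.inl ⟨z, hzh, hX.projParam_of_mem_segment ha he hz⟩
  · exact Or.inr (Or.inl ⟨z, hz, hzh⟩)
  · exact Or.inr (Or.inr ⟨z, hzh, hX.projParam_of_mem_segment ha hf hz⟩)

/-- Every member is among the first or last `N + 2`, or meets the fibre over the projection of `x`
or of `y` (at most one member each), or crosses the segment from `x` to `y`: at most one member
early, at most `N + 2` members on the rest of the segment, which is shorter than `N + 1`. -/
theorem IsLChain.card_le_of_dist_lt (hX : IsCAT0 X) (ha : IsClosedGeodesic a I)
    (hc : IsLChain N c) (hs : ∀ i, (c i).Separates {a (projParam a I x)} {a (projParam a I y)})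
    (hxy : dist x y < dist x (a (projParam a I x))) : n ≤ 3 * N + 9 := by
  obtain ⟨α, hα⟩ := hX.exists_segment x y
  have hp := ha.projParam_mem x
  have hq := ha.projParam_mem y
  set H := dist x (a (projParam a I x))
  let middle (i : Fin n) : Prop := N + 2 ≤ (i : ℕ) ∧ (i : ℕ) + (N + 2) < n
  let P : Fin 6 → Fin n → Prop := ![
    fun i => (i : ℕ) < N + 2,
    fun i => n ≤ (i : ℕ) + (N + 2),
    fun i => middle i ∧ ∃ z ∈ (c i).carrier, projParam a I z = projParam a I x,
    fun i => middle i ∧ ∃ z ∈ (c i).carrier, projParam a I z = projParam a I y,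
    fun i => ∃ z ∈ (c i).carrier, dist x z < H - (N + 1),
    fun i => ∃ z ∈ α '' Icc 0 (dist x y), z ∈ (c i).carrier ∧ H - (N + 1) ≤ dist x z]
  have hcover : ∀ i, ∃ l, P l i := by
    intro i
    rcases lt_or_ge (i : ℕ) (N + 2) with hi | hi
    · exact ⟨0, hi⟩
    rcases le_or_gt n ((i : ℕ) + (N + 2)) with hi' | hi'
    · exact ⟨1, hi'⟩
    rcases (hs i).exists_mem_carrier_of_projParam hX ha hα with hz | ⟨z, hz, hzi⟩ | hz
    · exact ⟨2, ⟨hi, hi'⟩, hz⟩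
    · exact (lt_or_ge (dist x z) (H - (N + 1))).elim (fun hlt => ⟨4, z, hzi, hlt⟩)
        fun hge => ⟨5, z, hz, hzi, hge⟩
    · exact ⟨3, ⟨hi, hi'⟩, hz⟩
  have hP : ∀ l ⦃i j⦄, P l i → P l j → (i : ℕ) < j + ![N + 2, N + 2, 1, 1, 1, N + 2] l := by
    refine Fin.forall_fin_succ.2 ⟨fun i j => ?_, Fin.forall_fin_succ.2 ⟨fun i j => ?_,
      Fin.forall_fin_succ.2 ⟨fun i j => ?_, Fin.forall_fin_succ.2 ⟨fun i j => ?_,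
      Fin.forall_fin_two.2 ⟨fun i j => ?_, fun i j => ?_⟩⟩⟩⟩⟩
    · exact fun (hi : (i : ℕ) < N + 2) _ => hi.trans_le (Nat.le_add_left _ _)
    · exact fun _ (hj : n ≤ (j : ℕ) + (N + 2)) => i.2.trans_le hj
    · exact fun hi hj => hc.eq_of_projParam_eq hX ha hp hq hs hi hj ▸ Nat.lt_succ_self _
    · exact fun hi hj => hc.eq_of_projParam_eq hX ha hq hp (fun i => (hs i).symm) hi hj ▸
        Nat.lt_succ_self _
    · exact fun hi hj => hc.eq_of_dist_lt hX ha hp hq hs hi hj ▸ Nat.lt_succ_self _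
    · rintro ⟨z, hz, hzi, hxz⟩ ⟨w, hw, hwj, hxw⟩
      exact hc.1.lt_add_of_dist_lt hX (m := N + 1) hzi hwj
        (by exact_mod_cast hα.dist_lt_of_lt hz hw hxz hxw hxy)
  calc n ≤ ∑ l, ![N + 2, N + 2, 1, 1, 1, N + 2] l := card_le_sum_of_forall_exists hcover hP
    _ = 3 * N + 9 :=
      (Fin.sum_univ_six _).trans (by ring : N + 2 + (N + 2) + 1 + 1 + 1 + (N + 2) = 3 * N + 9)

end LongChains

/-! ### Distances in the curtain model -/

section CurtainModel

variable {X : Type*} [MetricSpace X] {L N n : ℕ} {h k : Curtain X} {c : Fin n → Curtain X} {x y : X}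

theorem IsLSeparated.mono (hLN : L ≤ N) (hs : IsLSeparated L h k) : IsLSeparated N h k :=
  ⟨hs.1, fun n c hc hm => (hs.2 n c hc hm).trans hLN⟩

theorem IsLChain.mono (hLN : L ≤ N) (hc : IsLChain L c) : IsLChain N c :=
  ⟨hc.1, fun i j hij => (hc.2 i j hij).mono hLN⟩

theorem dL_le_of_forall {r : ℝ} (hr : 0 ≤ r)
    (h : ∀ (n : ℕ) (c : Fin n → Curtain X), IsLChain L c → (∀ i, (c i).Separates {x} {y}) →
      (n : ℝ) ≤ r) : dL L x y ≤ ENNReal.ofReal (1 + r) := by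
  rw [dL]
  split_ifs with hxy
  · exact zero_le
  rw [ENNReal.ofReal_add zero_le_one hr, ENNReal.ofReal_one]
  gcongr
  refine iSup_le fun n => iSup_le fun c => iSup_le fun hc => iSup_le fun hs => ?_
  rw [← ENNReal.ofReal_natCast]
  exact ENNReal.ofReal_le_ofReal (h n c hc hs)

theorem le_dL_of_isLChain (hxy : x ≠ y) (hc : IsLChain L c)
    (hs : ∀ i, (c i).Separates {x} {y}) : ENNReal.ofReal (1 + n) ≤ dL L x y := by
  rw [dL, if_neg hxy, ENNReal.ofReal_add zero_le_one (Nat.cast_nonneg n), ENNReal.ofReal_one,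
    ENNReal.ofReal_natCast]
  gcongr
  exact le_iSup_of_le n (le_iSup_of_le c (le_iSup_of_le hc (le_iSup_of_le hs le_rfl)))

theorem natCast_pow_three_eq_ofReal (L : ℕ) :
    (L : ℝ≥0∞) ^ 3 = ENNReal.ofReal ((L : ℝ) ^ 3) := by
  rw [ENNReal.ofReal_pow (Nat.cast_nonneg L), ENNReal.ofReal_natCast]

theorem le_dHat_of_isLChain (hL : 0 < L) (hxy : x ≠ y) (hc : IsLChain L c)
    (hs : ∀ i, (c i).Separates {x} {y}) :
    ENNReal.ofReal ((1 + n) / (L : ℝ) ^ 3) ≤ dHat x y := by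
  obtain ⟨l, rfl⟩ := Nat.exists_eq_add_of_lt hL
  rw [zero_add] at hc ⊢
  rw [ENNReal.ofReal_div_of_pos (by positivity), ← natCast_pow_three_eq_ofReal]
  exact (ENNReal.div_le_div_right (le_dL_of_isLChain hxy hc hs) _).trans
    (ENNReal.le_tsum (f := fun l : ℕ => dL (l + 1) x y / ((l + 1 : ℕ) : ℝ≥0∞) ^ 3) l)

/-- The sum of `1 / L²` is `π² / 6 ≤ 2`. -/
theorem dHat_le_of_dL_le {B : ℝ} (hB : 0 ≤ B)
    (h : ∀ L : ℕ, 0 < L → dL L x y ≤ ENNReal.ofReal (B * L)) :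
    dHat x y ≤ ENNReal.ofReal (2 * B) := by
  have hzeta : HasSum (fun L : ℕ => B * (1 / ((L + 1 : ℕ) : ℝ) ^ 2)) (B * (Real.pi ^ 2 / 6)) := by
    simpa using ((hasSum_nat_add_iff' 1).2 hasSum_zeta_two).mul_left B
  have hterm : ∀ L : ℕ, dL (L + 1) x y / ((L + 1 : ℕ) : ℝ≥0∞) ^ 3 ≤
      ENNReal.ofReal (B * (1 / ((L + 1 : ℕ) : ℝ) ^ 2)) := fun L => by
    have hdiv : B * (1 / ((L + 1 : ℕ) : ℝ) ^ 2) = B * (L + 1 : ℕ) / ((L + 1 : ℕ) : ℝ) ^ 3 := by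
      field_simp
    rw [natCast_pow_three_eq_ofReal, hdiv, ENNReal.ofReal_div_of_pos (by positivity)]
    gcongr
    exact h (L + 1) L.succ_pos
  calc dHat x y ≤ ∑' L : ℕ, ENNReal.ofReal (B * (1 / ((L + 1 : ℕ) : ℝ) ^ 2)) :=
        ENNReal.tsum_le_tsum hterm
    _ = ENNReal.ofReal (B * (Real.pi ^ 2 / 6)) := by
      rw [← ENNReal.ofReal_tsum_of_nonneg (fun L => by positivity) hzeta.summable, hzeta.tsum_eq]
    _ ≤ ENNReal.ofReal (2 * B) := by
      rw [mul_comm 2]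
      gcongr
      nlinarith [Real.pi_lt_d2, Real.pi_pos]

theorem IsCAT0.dHat_le (hX : IsCAT0 X) {m : ℕ} (hN : 0 < N)
    (h : ∀ (n : ℕ) (c : Fin n → Curtain X), IsLChain N c → (∀ i, (c i).Separates {x} {y}) →
      n ≤ m) : dHat x y ≤ ENNReal.ofReal (2 * (1 + m + (1 + dist x y) / N)) := by
  have hd : 0 ≤ dist x y := dist_nonneg
  refine dHat_le_of_dL_le (by positivity) fun L hL => ?_
  have hL' : (1 : ℝ) ≤ L := by exact_mod_cast hL
  have hN' : (0 : ℝ) < N := by exact_mod_cast hN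
  rcases le_total L N with hLN | hNL
  · refine (dL_le_of_forall (r := m) (Nat.cast_nonneg m) fun n c hc hs => by
      exact_mod_cast h n c (hc.mono hLN) hs).trans (ENNReal.ofReal_le_ofReal ?_)
    refine le_trans ?_ (le_mul_of_one_le_right (by positivity) hL')
    linarith [(by positivity : 0 ≤ (1 + dist x y) / N)]
  · refine (dL_le_of_forall hd fun n c hc hs => hc.1.card_le_dist hX hs).trans
      (ENNReal.ofReal_le_ofReal ?_)
    calc 1 + dist x y = (1 + dist x y) / N * N := (div_mul_cancel₀ _ hN'.ne').symm
      _ ≤ (1 + m + (1 + dist x y) / N) * L := by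
        gcongr
        linarith [(Nat.cast_nonneg m : (0 : ℝ) ≤ m)]

end CurtainModel

/-! ### Doubling functions -/

section Doubling

/-- `κ` on `[0, ∞)` grows at most by the factor `A` when its argument at most doubles. Sublinear
functions enter the argument only through this property and their growth. -/
def IsDoublingWith (A : ℝ) (κ : ℝ → ℝ) : Prop :=
  ∀ ⦃s t⦄, 0 ≤ s → s ≤ 2 * t → κ s ≤ A * κ t

variable {κ : ℝ → ℝ} {A : ℝ}

theorem IsSublinearFunction.isDoublingWith (hκ : IsSublinearFunction κ) : IsDoublingWith 2 κ := by
  intro s t hs hst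
  have hhalf : (0 : ℝ) ≤ 1 / 2 := by norm_num
  have hmid := hκ.concaveOn.2 self_mem_Ici (mem_Ici.2 (hs.trans hst)) hhalf hhalf (by norm_num)
  simp only [smul_eq_mul, mul_zero, zero_add, show 1 / 2 * (2 * t) = t by ring] at hmid
  linarith [hκ.one_le 0 le_rfl, hκ.monotoneOn (mem_Ici.2 hs) (mem_Ici.2 (hs.trans hst)) hst]

namespace IsDoublingWith

theorem one_le (hd : IsDoublingWith A κ) (hκ : ∀ t, 0 ≤ t → 1 ≤ κ t) : 1 ≤ A := by
  have h0 := hκ 0 le_rfl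
  exact le_of_mul_le_mul_right (by linarith [hd le_rfl (mul_zero (2 : ℝ)).ge])
    (zero_lt_one.trans_le h0)

theorem exists_le_mul_add (hd : IsDoublingWith A κ) (hκ : ∀ t, 0 ≤ t → 1 ≤ κ t)
    (hgrow : GrowsSublinearly κ) {ε : ℝ} (hε : 0 < ε) :
    ∃ B : ℝ, 0 ≤ B ∧ ∀ t, 0 ≤ t → κ t ≤ ε * t + B := by
  obtain ⟨T, hT⟩ := eventually_atTop.1
    ((hgrow.eventually (gt_mem_nhds hε)).and (eventually_gt_atTop 0))
  have hT0 : 0 < T := (hT T le_rfl).2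
  have hB : 0 ≤ A * κ T :=
    mul_nonneg (zero_le_one.trans (hd.one_le hκ)) (zero_le_one.trans (hκ T hT0.le))
  refine ⟨A * κ T, hB, fun t ht => ?_⟩
  rcases le_total T t with hle | hle
  · obtain ⟨hlt, ht0⟩ := hT t hle
    rw [div_lt_iff₀ ht0] at hlt
    linarith
  · linarith [hd ht (by linarith : t ≤ 2 * T), mul_nonneg hε.le ht]

/-- Where the argument more than doubles, the window `K * κ t` exceeds `t`, and sublinear growth
takes over. -/
theorem exists_scale (hd : IsDoublingWith A κ) (hκ : ∀ t, 0 ≤ t → 1 ≤ κ t)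
    (hgrow : GrowsSublinearly κ) {C : ℝ} (hC : 0 ≤ C) :
    ∃ K : ℝ, 0 < K ∧ ∀ t, 0 ≤ t → ∀ s, 0 ≤ s → s ≤ t + K * κ t → C * κ s ≤ K * κ t / 20 := by
  obtain ⟨B, hB, hκB⟩ := hd.exists_le_mul_add hκ hgrow (ε := 1 / (80 * (C + 1))) (by positivity)
  have hA := hd.one_le hκ
  have hCA : 0 ≤ C * A := by positivity
  have hCB : 0 ≤ C * B := by positivity
  refine ⟨20 * (C * A) + 40 * (C * B) + 1, by positivity, fun t ht s hs hst => ?_⟩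
  set K := 20 * (C * A) + 40 * (C * B) + 1
  have hκt := hκ t ht
  rcases le_or_gt s (2 * t) with hle | hlt
  · have hκs := mul_le_mul_of_nonneg_left (hd hs hle) hC
    nlinarith
  · have hκs : C * κ s ≤ C * (1 / (80 * (C + 1)) * s + B) := by gcongr; exact hκB s hs
    have hε : C * (1 / (80 * (C + 1))) ≤ 1 / 80 := by
      rw [mul_one_div, div_le_div_iff₀ (by positivity) (by norm_num)]
      linarith
    have hεs := mul_le_mul_of_nonneg_right hε hs
    nlinarith

end IsDoublingWith

end Doubling

/-! ### Rays with a persistent shadow -/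

section PersistentShadow

variable {X : Type*} [MetricSpace X] {o : X} {b : ℝ → X} {κ : ℝ → ℝ} {A : ℝ}

namespace IsGeodesicRay

theorem isClosedGeodesic (hb : IsGeodesicRay o b) : IsClosedGeodesic b (Ici 0) :=
  ⟨hb.1, ordConnected_Ici, isClosed_Ici, nonempty_Ici⟩

theorem projParam_origin (hX : IsCAT0 X) (hb : IsGeodesicRay o b) : projParam b (Ici 0) o = 0 := by
  rw [← hb.2]
  exact hX.projParam_self hb.isClosedGeodesic self_mem_Ici

theorem projParam_le (hX : IsCAT0 X) (hb : IsGeodesicRay o b) (x : X) :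
    projParam b (Ici 0) x ≤ dist o x := by
  have h := hX.abs_projParam_sub_le hb.isClosedGeodesic x o
  rw [hb.projParam_origin hX, sub_zero, dist_comm] at h
  exact (le_abs_self _).trans h

theorem dist_projParam_le (hb : IsGeodesicRay o b) (x : X) :
    dist x (b (projParam b (Ici 0) x)) ≤ dist o x := by
  rw [dist_comm o x, ← hb.2]
  exact hb.isClosedGeodesic.dist_projParam_le x self_mem_Ici

end IsGeodesicRay

/-- Comparing the bounds for `N` between `4 * w / C` and `4 * w / C + 1`: the term `(1 + T) / N`
then absorbs at most half of the shadow. -/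
theorem le_mul_sq_of_shadow_le {C w T N : ℝ} (hC : 0 < C) (hw : 1 ≤ w) (hT : 0 ≤ T)
    (hN : 4 * w / C ≤ N) (hN' : N ≤ 4 * w / C + 1)
    (h : C * (T / w) - C ≤ 2 * (10 + 3 * N + (1 + T) / N)) :
    T ≤ 2 / C * (2 * C + 26 + 24 / C) * w ^ 2 := by
  have : 0 < w := zero_lt_one.trans_le hw
  have habsorb : (1 + T) / N ≤ (1 + T) * (C / (4 * w)) := by
    rw [div_eq_mul_inv, ← inv_div]
    gcongr
  have hsmall : C / (4 * w) ≤ C / 2 := by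
    gcongr
    linarith
  have hsplit : C * (T / w) = 4 * (T * (C / (4 * w))) := by field_simp
  have hhalf : 2 * (T * (C / (4 * w))) ≤ (2 * C + 26 + 24 / C) * w := by
    have hNw : 6 * (4 * w / C) = 24 / C * w := by ring
    have hCw : 2 * C + 26 ≤ (2 * C + 26) * w := le_mul_of_one_le_right (by positivity) hw
    linarith
  calc T = 2 / C * w * (2 * (T * (C / (4 * w)))) := by field_simp; ring
    _ ≤ 2 / C * w * ((2 * C + 26 + 24 / C) * w) :=
      mul_le_mul_of_nonneg_left hhalf (by positivity)
    _ = 2 / C * (2 * C + 26 + 24 / C) * w ^ 2 := by ring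

/-- The chain bound at `N ≈ κ / C` caps the distance in the curtain model between the
projections. -/
theorem IsGeodesicRay.abs_projParam_sub_le_of_shadow (hX : IsCAT0 X)
    (hκ : ∀ t, 0 ≤ t → 1 ≤ κ t) (hd : IsDoublingWith A κ) (hb : IsGeodesicRay o b) {C : ℝ}
    (hC : 0 < C) (hshadow : ∀ s t : ℝ, 0 ≤ s → s < t →
      ENNReal.ofReal (C * ((t - s) / κ t) - C) ≤ dHat (b s) (b t))
    {x y : X} (hxy : dist x y < dist x (b (projParam b (Ici 0) x))) :
    |projParam b (Ici 0) x - projParam b (Ici 0) y| ≤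
      2 / C * (2 * C + 26 + 24 / C) * (A * κ (dist o x)) ^ 2 := by
  have ha := hb.isClosedGeodesic
  set w := A * κ (dist o x)
  have hw : 1 ≤ w := one_le_mul_of_one_le_of_one_le (hd.one_le hκ) (hκ _ dist_nonneg)
  have hw0 : 0 < 4 * w / C := by positivity
  have hbound : ∀ s t, 0 ≤ s → s < t → t ≤ 2 * dist o x →
      (∀ (n : ℕ) (c : Fin n → Curtain X), IsLChain ⌈4 * w / C⌉₊ c →
        (∀ i, (c i).Separates {b s} {b t}) → n ≤ 3 * ⌈4 * w / C⌉₊ + 9) →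
      |s - t| ≤ 2 / C * (2 * C + 26 + 24 / C) * w ^ 2 := fun s t hs hst ht hchain => by
    have hlt : 0 < t - s := sub_pos.2 hst
    have h := (hshadow s t hs hst).trans (hX.dHat_le (Nat.ceil_pos.2 hw0) hchain)
    rw [hb.1.dist_eq_sub hs (hs.trans hst.le) hst.le, ENNReal.ofReal_le_ofReal_iff (by positivity)]
      at h
    have hκt : C * ((t - s) / w) ≤ C * ((t - s) / κ t) := by
      have hκt0 := zero_lt_one.trans_le (hκ t (hs.trans hst.le))
      gcongr
      exact hd (hs.trans hst.le) ht
    rw [abs_sub_comm, abs_of_pos hlt]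
    refine le_mul_sq_of_shadow_le hC hw hlt.le (Nat.le_ceil _) (Nat.ceil_lt_add_one hw0.le).le ?_
    push_cast at h
    linarith
  have hp : projParam b (Ici 0) x ≤ dist o x := hb.projParam_le hX x
  have hq : projParam b (Ici 0) y ≤ 2 * dist o x := by
    linarith [hb.projParam_le hX y, dist_triangle o x y, hb.dist_projParam_le x]
  rcases lt_trichotomy (projParam b (Ici 0) x) (projParam b (Ici 0) y) with hlt | heq | hgt
  · exact hbound _ _ (ha.projParam_mem x) hlt hq fun n c hc hs =>
      hc.card_le_of_dist_lt hX ha hs hxy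
  · rw [heq, sub_self, abs_zero]
    positivity
  · rw [abs_sub_comm]
    exact hbound _ _ (ha.projParam_mem y) hgt (hp.trans (by linarith [@dist_nonneg _ _ o x]))
      fun n c hc hs => hc.card_le_of_dist_lt hX ha (fun i => (hs i).symm) hxy

theorem IsGeodesicRay.isContractingRay_of_forall (hX : IsCAT0 X) (hb : IsGeodesicRay o b)
    {f : ℝ → ℝ} (hf : ∀ t, 0 ≤ t → 0 < f t) {K : ℝ} (hK : 0 ≤ K)
    (h : ∀ x y, dist x y < dist x (b (projParam b (Ici 0) x)) →
      |projParam b (Ici 0) x - projParam b (Ici 0) y| ≤ K * f (dist o x)) :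
    IsContractingRay f o b := by
  have ha := hb.isClosedGeodesic
  refine ⟨2 * K + 1, by positivity, fun x ρ _ hdisj => ?_⟩
  have hfx : 0 < f (dist o x) := hf _ dist_nonneg
  have hρ : ρ ≤ dist x (b (projParam b (Ici 0) x)) := le_of_not_gt fun hlt =>
    Set.disjoint_left.1 hdisj (Metric.mem_ball'.2 hlt) (mem_image_of_mem b (ha.projParam_mem x))
  have hclose : ∀ y ∈ Metric.ball x ρ, ∀ s ∈ Ici (0 : ℝ), IsClosest (b '' Ici 0) y (b s) →
      |projParam b (Ici 0) x - s| ≤ K * f (dist o x) := fun y hy s hs hys => by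
    have hxy := h x y ((Metric.mem_ball'.1 hy).trans_le hρ)
    rwa [hX.projParam_eq ha hs hys] at hxy
  have hle : Metric.ediam (projImage (b '' Ici 0) (Metric.ball x ρ)) ≤
      ENNReal.ofReal (2 * K * f (dist o x)) := by
    refine Metric.ediam_le ?_
    rintro _ ⟨y, hy, ⟨⟨s, hs, rfl⟩, hys⟩⟩ _ ⟨z, hz, ⟨⟨t, ht, rfl⟩, hzt⟩⟩
    rw [edist_dist, hb.1 s hs t ht]
    refine ENNReal.ofReal_le_ofReal ((abs_sub_le s (projParam b (Ici 0) x) t).trans ?_)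
    rw [abs_sub_comm s]
    linarith [hclose y hy s hs ⟨mem_image_of_mem b hs, hys⟩,
      hclose z hz t ht ⟨mem_image_of_mem b ht, hzt⟩]
  refine hle.trans_lt ((ENNReal.ofReal_lt_ofReal_iff (by positivity)).2 ?_)
  linarith

theorem HasPersistentShadow.isContractingRay (hX : IsCAT0 X) (hκ : ∀ t, 0 ≤ t → 1 ≤ κ t)
    (hd : IsDoublingWith A κ) (hb : IsGeodesicRay o b) (h : HasPersistentShadow κ b) :
    IsContractingRay (fun t => κ t ^ 2) o b := by
  obtain ⟨C, hC, hshadow⟩ := h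
  refine hb.isContractingRay_of_forall hX (K := 2 / C * (2 * C + 26 + 24 / C) * A ^ 2)
    (fun t ht => pow_pos (zero_lt_one.trans_le (hκ t ht)) 2) (by positivity) fun x y hxy => ?_
  rw [mul_assoc, ← mul_pow]
  exact hb.abs_projParam_sub_le_of_shadow hX hκ hd hC hshadow hxy

end PersistentShadow

/-! ### Geodesics contracting at a given scale -/

theorem exists_last_time {f : ℝ → ℝ} {α β v : ℝ} (hαβ : α ≤ β) (hf : ContinuousOn f (Icc α β))
    (hα : f α ≤ v) (hβ : v ≤ f β) : ∃ s ∈ Icc α β, f s = v ∧ ∀ u ∈ Icc s β, v ≤ f u := by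
  have hcompact : IsCompact (Icc α β ∩ f ⁻¹' {v}) := isCompact_Icc.of_isClosed_subset
    (hf.preimage_isClosed_of_isClosed isClosed_Icc isClosed_singleton) inter_subset_left
  obtain ⟨s, ⟨hs, hsv⟩, hmax⟩ :=
    hcompact.exists_isGreatest (intermediate_value_Icc hαβ hf ⟨hα, hβ⟩)
  refine ⟨s, hs, hsv, fun u hu => ?_⟩
  by_contra! hlt
  have hsub : Icc u β ⊆ Icc α β := Icc_subset_Icc_left (hs.1.trans hu.1)
  obtain ⟨t, ht, htv⟩ := intermediate_value_Icc hu.2 (hf.mono hsub) ⟨hlt.le, hβ⟩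
  obtain rfl : u = s := le_antisymm (ht.1.trans (hmax ⟨hsub ht, htv⟩)) hu.1
  exact hlt.ne hsv

theorem exists_first_time {f : ℝ → ℝ} {α β w : ℝ} (hαβ : α ≤ β) (hf : ContinuousOn f (Icc α β))
    (hα : f α ≤ w) (hβ : w ≤ f β) : ∃ s ∈ Icc α β, f s = w ∧ ∀ u ∈ Icc α s, f u ≤ w := by
  have hneg : MapsTo Neg.neg (Icc (-β) (-α)) (Icc α β) := fun t ht =>
    ⟨le_neg_of_le_neg ht.2, neg_le_of_neg_le ht.1⟩
  obtain ⟨s, hs, hsw, hlast⟩ := exists_last_time (f := fun t => -f (-t)) (v := -w)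
    (neg_le_neg hαβ) (hf.comp continuous_neg.continuousOn hneg).neg
    (by simpa using hβ) (by simpa using hα)
  refine ⟨-s, hneg hs, neg_injective hsw, fun u hu => ?_⟩
  simpa using hlast (-u) ⟨le_neg_of_le_neg hu.2, neg_le_neg hu.1⟩

theorem exists_crossing {f : ℝ → ℝ} {α β v w : ℝ} (hαβ : α ≤ β) (hf : ContinuousOn f (Icc α β))
    (hvw : v ≤ w) (hα : f α ≤ v) (hβ : w ≤ f β) :
    ∃ s t, α ≤ s ∧ s ≤ t ∧ t ≤ β ∧ f s = v ∧ f t = w ∧ MapsTo f (Icc s t) (Icc v w) := by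
  obtain ⟨s, hs, hsv, hlast⟩ := exists_last_time hαβ hf hα (hvw.trans hβ)
  obtain ⟨t, ht, htw, hfirst⟩ := exists_first_time hs.2 (hf.mono (Icc_subset_Icc_left hs.1))
    (hsv.le.trans hvw) hβ
  exact ⟨s, t, hs.1, ht.1, ht.2, hsv, htw, fun u hu =>
    ⟨hlast u ⟨hu.1, hu.2.trans ht.2⟩, hfirst u hu⟩⟩

section Contracting

variable {X : Type*} [MetricSpace X] {a : ℝ → X} {I : Set ℝ}

namespace IsCAT0

variable {γ : ℝ → X} {x y z : X} {p t m R : ℝ}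

theorem projParam_of_mem_segment_symm (hX : IsCAT0 X) (ha : IsClosedGeodesic a I)
    (hγ : IsSegment γ (a (projParam a I x)) x)
    (hy : y ∈ γ '' Icc 0 (dist (a (projParam a I x)) x)) : projParam a I y = projParam a I x := by
  refine hX.projParam_eq_of_dist_add ha ?_
  rw [dist_comm x y, dist_comm x (a _), ← hγ.dist_add_dist hy, add_comm, dist_comm y (a _)]

theorem dist_lt_of_mem_segment (hX : IsCAT0 X) (ha : IsClosedGeodesic a I)
    (hp : projParam a I x = p) (hγ : IsSegment γ x (a p)) {s : ℝ} (hs : s ∈ Ioo 0 (dist x (a p)))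
    (ht : t ∈ I) : dist (γ s) (a t) < dist x (a t) := by
  subst hp
  have hs' := Ioo_subset_Icc_self hs
  have hd : 0 < dist x (a (projParam a I x)) := hs.1.trans hs.2
  have hfoot : dist (a (projParam a I x)) (a t) < dist (γ s) (a t) := by
    have hpyth := hX.pythagoras ha (γ s) ht
    rw [hX.projParam_of_mem_segment ha hγ (mem_image_of_mem γ hs'), hγ.dist_right hs'] at hpyth
    rw [ha.isGeodesicOn _ (ha.projParam_mem x) _ ht, abs_sub_comm, ← abs_dist (a := γ s),
      ← sq_lt_sq]
    linarith [pow_pos (sub_pos.2 hs.2) 2]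
  have hτ : s / dist x (a (projParam a I x)) < 1 := (div_lt_one hd).2 hs.2
  have hτ0 : 0 < s / dist x (a (projParam a I x)) := div_pos hs.1 hd
  have hconv := hX.dist_geodesic_le hγ.1 ordConnected_Icc (left_mem_Icc.2 hd.le)
    (right_mem_Icc.2 hd.le) (a t) ⟨hτ0.le, hτ.le⟩
  rw [hγ.2.1, hγ.2.2, mul_zero, zero_add, div_mul_cancel₀ _ hd.ne'] at hconv
  have hlt := mul_lt_mul_of_pos_left hfoot hτ0
  refine lt_of_mul_lt_mul_left (a := 1 - s / dist x (a (projParam a I x))) ?_ (sub_pos.2 hτ).le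
  linarith

/-- A geodesic that has receded from `z` fast enough by the time `R` keeps receding at unit
speed. -/
theorem add_dist_le_of_segment (hX : IsCAT0 X) (hγ : IsSegment γ x y) (hm : 0 ≤ m) (hR : 0 < R)
    (hRy : R ≤ dist x y) (hx : dist x z ≤ m + R)
    (hz : (m + R) ^ 2 + R * (2 * m + R) ≤ dist (γ R) z ^ 2) : m + dist x y ≤ dist y z := by
  have hd : 0 < dist x y := hR.trans_le hRy
  have hstewart := hX.stewart hγ z (τ := R / dist x y) ⟨by positivity, (div_le_one hd).2 hRy⟩
  rw [div_mul_cancel₀ R hd.ne'] at hstewart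
  have hscaled : dist x y * dist (γ R) z ^ 2 ≤
      (dist x y - R) * dist x z ^ 2 + R * dist y z ^ 2 - R * (dist x y - R) * dist x y := by
    refine (mul_le_mul_of_nonneg_left hstewart hd.le).trans_eq ?_
    field_simp
  have hnear : (dist x y - R) * dist x z ^ 2 ≤ (dist x y - R) * (m + R) ^ 2 := by
    have := sub_nonneg.2 hRy
    gcongr
  have hfar := mul_le_mul_of_nonneg_left hz hd.le
  refine le_of_sq_le_sq (le_of_mul_le_mul_left ?_ hR) dist_nonneg
  nlinarith [mul_nonneg (mul_nonneg hR.le hR.le) hm, mul_pos (mul_pos hR hR) hR]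

end IsCAT0

/-- Balls that just avoid `a`, have radius `R` and are centred above parameters in `W` have
projections to `a` that are small compared to `R`. -/
def IsContractingAtScale (a : ℝ → X) (I : Set ℝ) (R : ℝ) (W : Set ℝ) : Prop :=
  ∀ x, projParam a I x ∈ W → dist x (a (projParam a I x)) = R →
    ∀ y, dist x y < R → |projParam a I x - projParam a I y| ≤ R / 20

namespace IsContractingAtScale

variable {R v : ℝ} {V W : Set ℝ} {x y : X}

theorem mono (hVW : V ⊆ W) (h : IsContractingAtScale a I R W) : IsContractingAtScale a I R V :=
  fun x hx => h x (hVW hx)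

/-- Otherwise a ball around `x` and a ball around `y` would cover enough of the segment from `x`
to `y` for its projection to be short. -/
theorem le_dist (hX : IsCAT0 X) (ha : IsClosedGeodesic a I) (hR : 0 < R)
    (h : IsContractingAtScale a I R W) (hx : projParam a I x ∈ W) (hy : projParam a I y ∈ W)
    (hxR : dist x (a (projParam a I x)) = R) (hyR : dist y (a (projParam a I y)) = R)
    (hxy : R ≤ |projParam a I x - projParam a I y|) :
    |projParam a I x - projParam a I y| + 37 / 20 * R ≤ dist x y := by
  obtain ⟨β, hβ⟩ := hX.exists_segment x y
  have hshort : ∀ s ∈ Icc 0 (dist x y), ∀ t ∈ Icc 0 (dist x y), s ≤ t → s < R →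
      dist x y - t < R → |projParam a I x - projParam a I y| ≤ (t - s) + R / 10 := by
    intro s hs t ht hst hsR htR
    have hxs := h x hx hxR (β s) (by rwa [hβ.dist_left hs])
    have hyt := h y hy hyR (β t) (by rwa [dist_comm, hβ.dist_right ht])
    have hst' := hX.abs_projParam_sub_le ha (β s) (β t)
    rw [hβ.1.dist_eq_sub hs ht hst] at hst'
    rw [abs_le] at hxs hyt hst' ⊢
    constructor <;> linarith
  have hd : 0 ≤ dist x y := dist_nonneg
  rcases lt_or_ge (dist x y / 2) R with hlt | hge
  · have hmid : dist x y / 2 ∈ Icc 0 (dist x y) := ⟨by linarith, by linarith⟩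
    linarith [hshort _ hmid _ hmid le_rfl hlt (by linarith)]
  · linarith [hshort (39 / 40 * R) ⟨by linarith, by linarith⟩ (dist x y - 39 / 40 * R)
      ⟨by linarith, by linarith⟩ (by linarith) (by linarith) (by linarith)]

theorem add_dist_le (hX : IsCAT0 X) (ha : IsClosedGeodesic a I) (hR : 0 < R)
    (h : IsContractingAtScale a I R W) (hx : projParam a I x ∈ W) (hy : projParam a I y ∈ W)
    (hxR : dist x (a (projParam a I x)) = R) (hyR : R ≤ dist y (a (projParam a I y)))
    (hle : R ≤ |projParam a I x - projParam a I y|)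
    (hge : |projParam a I x - projParam a I y| ≤ 2 * R) :
    |projParam a I x - projParam a I y| + dist y (a (projParam a I y)) ≤ dist x y := by
  obtain ⟨f, hf⟩ := hX.exists_segment (a (projParam a I y)) y
  rw [dist_comm y] at hyR
  have hmem : R ∈ Icc 0 (dist (a (projParam a I y)) y) := ⟨hR.le, hyR⟩
  have hproj := hX.projParam_of_mem_segment_symm ha hf (mem_image_of_mem f hmem)
  have hdist := h.le_dist (y := f R) hX ha hR hx (hproj ▸ hy) hxR
    (by rw [hproj, dist_comm, hf.dist_left hmem]) (hproj ▸ hle)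
  rw [hproj] at hdist
  have hfoot := dist_triangle (a (projParam a I y)) (a (projParam a I x)) x
  rw [ha.isGeodesicOn _ (ha.projParam_mem y) _ (ha.projParam_mem x), abs_sub_comm,
    dist_comm (a (projParam a I x)), hxR] at hfoot
  rw [dist_comm y, dist_comm x y]
  refine hX.add_dist_le_of_segment hf (abs_nonneg _) hR hyR hfoot ?_
  rw [dist_comm (f R)]
  calc _ ≤ (|projParam a I x - projParam a I y| + 37 / 20 * R) ^ 2 := by
        nlinarith [mul_nonneg hR.le (sub_nonneg.2 hge)]
    _ ≤ dist x (f R) ^ 2 := by gcongr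

/-- From a point of `γ` closest to `a` but further than `R` from it, descending towards `a` would
both increase and decrease the distance to `γ t`. -/
theorem dist_projParam_le (hX : IsCAT0 X) (ha : IsClosedGeodesic a I) (hR : 0 < R)
    (h : IsContractingAtScale a I R W) {γ : ℝ → X} {J : Set ℝ} (hγ : IsClosedGeodesic γ J)
    {s t : ℝ} (hs : s ∈ J) (ht : t ∈ J) (hsW : projParam a I (γ s) ∈ W)
    (htW : projParam a I (γ t) ∈ W)
    (hmin : IsMinOn (fun u => dist (γ u) (a (projParam a I (γ u)))) J s)
    (hle : R ≤ |projParam a I (γ s) - projParam a I (γ t)|)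
    (hge : |projParam a I (γ s) - projParam a I (γ t)| ≤ 2 * R) :
    dist (γ s) (a (projParam a I (γ s))) ≤ R := by
  by_contra! hlt
  have hpI := ha.projParam_mem (γ s)
  have hqI := ha.projParam_mem (γ t)
  obtain ⟨e, he⟩ := hX.exists_segment (a (projParam a I (γ s))) (γ s)
  have hIoo : R ∈ Ioo 0 (dist (a (projParam a I (γ s))) (γ s)) := ⟨hR, by rwa [dist_comm]⟩
  have hmem := Ioo_subset_Icc_self hIoo
  have hproj := hX.projParam_of_mem_segment_symm ha he (mem_image_of_mem e hmem)
  have hclosest : projParam γ J (a (projParam a I (γ s))) = s := by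
    refine hX.projParam_eq hγ hs ⟨mem_image_of_mem γ hs, forall_mem_image.2 fun u hu => ?_⟩
    rw [dist_comm, dist_comm _ (γ u)]
    exact (hmin hu).trans (ha.dist_projParam_le _ hpI)
  have hdecr := hX.dist_lt_of_mem_segment hγ hclosest he hIoo ht
  have hincr := h.add_dist_le (x := e R) (y := γ t) hX ha hR (hproj ▸ hsW) htW
    (by rw [hproj, dist_comm, he.dist_left hmem]) (hlt.le.trans (hmin ht)) (hproj ▸ hle)
    (hproj ▸ hge)
  rw [hproj, ← ha.isGeodesicOn _ hpI _ hqI, dist_comm (γ t)] at hincr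
  linarith [dist_triangle (a (projParam a I (γ s))) (a (projParam a I (γ t))) (γ t)]

theorem exists_near_of_segment (hX : IsCAT0 X) (ha : IsClosedGeodesic a I) (hR : 0 < R)
    (h : IsContractingAtScale a I R (Icc v (v + 2 * R))) {γ : ℝ → X} (hγ : IsSegment γ x y)
    (hx : projParam a I x ≤ v) (hy : v + 2 * R ≤ projParam a I y) :
    ∃ z ∈ γ '' Icc 0 (dist x y), projParam a I z ∈ Icc v (v + 2 * R) ∧
      dist z (a (projParam a I z)) ≤ R := by
  have hcont : ContinuousOn (fun s => projParam a I (γ s)) (Icc 0 (dist x y)) :=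
    (hX.lipschitzWith_projParam ha).continuous.comp_continuousOn hγ.1.continuousOn
  obtain ⟨s₁, s₂, h0, h₁₂, hd, hs₁, hs₂, hmaps⟩ := exists_crossing dist_nonneg hcont
    (by linarith : v ≤ v + 2 * R) (by rwa [hγ.2.1]) (by rwa [hγ.2.2])
  have hJ : Icc s₁ s₂ ⊆ Icc 0 (dist x y) := Icc_subset_Icc h0 hd
  have hγJ : IsClosedGeodesic γ (Icc s₁ s₂) := ⟨fun s hs t ht => hγ.1 s (hJ hs) t (hJ ht),
    ordConnected_Icc, isClosed_Icc, nonempty_Icc.2 h₁₂⟩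
  have hheight : ContinuousOn (fun s => dist (γ s) (a (projParam a I (γ s)))) (Icc s₁ s₂) :=
    continuous_dist.comp_continuousOn <| hγJ.isGeodesicOn.continuousOn.prodMk
      <| ha.isGeodesicOn.continuousOn.comp (hcont.mono hJ) fun s _ => ha.projParam_mem _
  obtain ⟨s, hs, hmin⟩ := isCompact_Icc.exists_isMinOn hγJ.nonempty hheight
  have hwin : v ≤ projParam a I (γ s) ∧ projParam a I (γ s) ≤ v + 2 * R := hmaps hs
  refine ⟨γ s, mem_image_of_mem γ (hJ hs), hwin, ?_⟩
  rcases le_total (projParam a I (γ s)) (v + R) with hle | hge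
  · have ht := right_mem_Icc.2 h₁₂
    refine h.dist_projParam_le hX ha hR hγJ hs ht (hmaps hs) (hmaps ht) hmin ?_ ?_ <;>
    · rw [hs₂, abs_sub_comm, abs_of_nonneg (by linarith)]
      linarith
  · have ht := left_mem_Icc.2 h₁₂
    refine h.dist_projParam_le hX ha hR hγJ hs ht (hmaps hs) (hmaps ht) hmin ?_ ?_ <;>
    · rw [hs₁, abs_of_nonneg (by linarith)]
      linarith

/-- The pole of `l` projects to a set of diameter at most `1`, so that `l` contains a segment
ending on its pole whose projection crosses one half of the window. -/
theorem exists_mem_carrier_near (hX : IsCAT0 X) (ha : IsClosedGeodesic a I) (hR : 0 < R)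
    (h : IsContractingAtScale a I R (Icc v (v + 4 * R + 1))) {l : Curtain X}
    (hx : x ∈ l.carrier) (hy : y ∈ l.carrier) (hxv : projParam a I x ≤ v)
    (hyv : v + 4 * R + 1 ≤ projParam a I y) :
    ∃ z ∈ l.carrier, projParam a I z ∈ Icc v (v + 4 * R + 1) ∧
      dist z (a (projParam a I z)) ≤ R := by
  have hl := l.isClosedGeodesic
  set P := l.path (projParam l.path l.I x)
  set Q := l.path (projParam l.path l.I y)
  have hfibre : ∀ w ∈ l.carrier, ∀ z, projParam l.path l.I z = projParam l.path l.I w →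
      z ∈ l.carrier := fun w hw z hz => by
    rwa [Curtain.mem_carrier_iff hX, Curtain.coord, hz, ← Curtain.coord,
      ← Curtain.mem_carrier_iff hX]
  have hPQ : |projParam a I P - projParam a I Q| ≤ 1 := by
    have hxl := (Curtain.mem_carrier_iff hX).1 hx
    have hyl := (Curtain.mem_carrier_iff hX).1 hy
    refine (hX.abs_projParam_sub_le ha P Q).trans ?_
    rw [hl.isGeodesicOn _ (hl.projParam_mem x) _ (hl.projParam_mem y)]
    rw [Curtain.coord, abs_le] at hxl hyl
    rw [abs_le]
    constructor <;> linarith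
  rcases le_total (v + 2 * R) (projParam a I P) with hle | hge
  · obtain ⟨γ, hγ⟩ := hX.exists_segment x P
    obtain ⟨z, hz, hzW, hzR⟩ := (h.mono (Icc_subset_Icc_right (by linarith))).exists_near_of_segment
      hX ha hR hγ hxv hle
    exact ⟨z, hfibre x hx z (hX.projParam_of_mem_segment hl hγ hz),
      ⟨hzW.1, by linarith [hzW.2]⟩, hzR⟩
  · obtain ⟨γ, hγ⟩ := hX.exists_segment Q y
    obtain ⟨z, hz, hzW, hzR⟩ := (h.mono (Icc_subset_Icc (by linarith) (by linarith)) :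
      IsContractingAtScale a I R (Icc (v + 2 * R + 1) (v + 2 * R + 1 + 2 * R))
      ).exists_near_of_segment hX ha hR hγ (by linarith [(abs_le.1 hPQ).1]) (by linarith)
    exact ⟨z, hfibre y hy z (hX.projParam_of_mem_segment_symm hl hγ hz),
      ⟨by linarith [hzW.1], by linarith [hzW.2]⟩, hzR⟩

theorem isLSeparated (hX : IsCAT0 X) (ha : IsClosedGeodesic a I) (hR : 0 < R) {r s : ℝ}
    (hrs : r + 4 * R + 2 ≤ s) (h : IsContractingAtScale a I R (Icc r s)) {k l : Curtain X}
    (hk : ∀ x, k.coord x = projParam a I x - r) (hl : ∀ x, l.coord x = projParam a I x - s)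
    (hdisj : Disjoint k.carrier l.carrier) {L : ℕ} (hL : 6 * R + 3 ≤ L) : IsLSeparated L k l := by
  refine ⟨hdisj, fun n c hc hm => ?_⟩
  have hnear : ∀ i, ∃ z ∈ (c i).carrier,
      projParam a I z ∈ Icc (r + 1 / 2) (r + 1 / 2 + 4 * R + 1) ∧
        dist z (a (projParam a I z)) ≤ R := fun i => by
    obtain ⟨⟨x, hxc, hxk⟩, ⟨y, hyc, hyl⟩⟩ := hm i
    rw [Curtain.mem_carrier_iff hX, hk, abs_le] at hxk
    rw [Curtain.mem_carrier_iff hX, hl, abs_le] at hyl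
    exact (h.mono (Icc_subset_Icc (by linarith) (by linarith))).exists_mem_carrier_near hX ha hR
      hxc hyc (by linarith) (by linarith)
  choose z hzc hzW hzR using hnear
  obtain ⟨g, hg⟩ := hc.exists_isNestedOrientation hX
  have hn : (n : ℝ) ≤ L := by
    rcases n with _ | _ | n
    · simp
    · push_cast
      linarith
    · have hlow := hg.sub_sub_one_le_dist hX (Fin.last_pos : 0 < Fin.last (n + 1)) (hzc _) (hzc _)
      have htri := dist_triangle4 (z 0) (a (projParam a I (z 0)))
        (a (projParam a I (z (Fin.last (n + 1))))) (z (Fin.last (n + 1)))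
      rw [ha.isGeodesicOn _ (ha.projParam_mem _) _ (ha.projParam_mem _),
        dist_comm (a (projParam a I (z (Fin.last (n + 1)))))] at htri
      have hwin := Real.dist_le_of_mem_Icc (hzW 0) (hzW (Fin.last (n + 1)))
      rw [Real.dist_eq] at hwin
      simp only [Fin.val_last, Fin.val_zero] at hlow
      push_cast at hlow ⊢
      linarith [hzR 0, hzR (Fin.last (n + 1))]
  exact_mod_cast hn

end IsContractingAtScale

end Contracting

/-! ### Contracting rays -/

section ContractingRay

variable {X : Type*} [MetricSpace X] {o : X} {b : ℝ → X} {κ : ℝ → ℝ} {A : ℝ}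

theorem IsGeodesicRay.abs_projParam_sub_le_of_ediam_lt (hb : IsGeodesicRay o b) {x y : X} {D : ℝ}
    (hcontr : ∀ ρ : ℝ, 0 < ρ → Disjoint (Metric.ball x ρ) (b '' Ici 0) →
      Metric.ediam (projImage (b '' Ici 0) (Metric.ball x ρ)) < ENNReal.ofReal D)
    (hxy : dist x y < dist x (b (projParam b (Ici 0) x))) :
    |projParam b (Ici 0) x - projParam b (Ici 0) y| ≤ D := by
  have ha := hb.isClosedGeodesic
  have hpos : 0 < dist x (b (projParam b (Ici 0) x)) := dist_nonneg.trans_lt hxy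
  have hdisj : Disjoint (Metric.ball x (dist x (b (projParam b (Ici 0) x)))) (b '' Ici 0) := by
    rw [Set.disjoint_left]
    rintro _ hmem ⟨u, hu, rfl⟩
    exact (Metric.mem_ball'.1 hmem).not_ge (ha.dist_projParam_le x hu)
  have hlt := (hcontr _ hpos hdisj).trans_le' (Metric.edist_le_ediam_of_mem
    ⟨x, Metric.mem_ball_self hpos, (ha.projParam_spec x).2⟩
    ⟨y, Metric.mem_ball'.2 hxy, (ha.projParam_spec y).2⟩)
  rw [edist_dist, hb.1 _ (ha.projParam_mem x) _ (ha.projParam_mem y)] at hlt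
  exact (ENNReal.ofReal_lt_ofReal_iff'.1 hlt).1.le

theorem IsContractingRay.exists_isContractingAtScale (hκ : ∀ t, 0 ≤ t → 1 ≤ κ t)
    (hd : IsDoublingWith A κ) (hgrow : GrowsSublinearly κ) (hb : IsGeodesicRay o b)
    (h : IsContractingRay κ o b) :
    ∃ K : ℝ, 0 < K ∧ ∀ t, 0 ≤ t → IsContractingAtScale b (Ici 0) (K * κ t) (Icc 0 t) := by
  obtain ⟨C, hC, hcontr⟩ := h
  obtain ⟨K, hK, hscale⟩ := hd.exists_scale hκ hgrow hC
  refine ⟨K, hK, fun t ht x hx hxR y hxy => ?_⟩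
  have hxt : dist o x ≤ t + K * κ t := by
    have htri := dist_triangle o (b (projParam b (Ici 0) x)) x
    rw [← hb.2, hb.1.dist_eq_sub self_mem_Ici hx.1 hx.1, hb.2, dist_comm (b _), hxR] at htri
    linarith [hx.2]
  exact (hb.abs_projParam_sub_le_of_ediam_lt (hcontr x) (hxR ▸ hxy)).trans
    (hscale t ht _ dist_nonneg hxt)

theorem IsContractingAtScale.exists_isLChain (hX : IsCAT0 X) {a : ℝ → X} {I : Set ℝ}
    (ha : IsClosedGeodesic a I) {R s t : ℝ} (hR : 0 < R) (hs : s ∈ I) (ht : t ∈ I)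
    (h : IsContractingAtScale a I R (Icc s t)) {n L : ℕ} (hn : (4 * R + 2) * n ≤ t - s)
    (hL : 6 * R + 3 ≤ L) :
    ∃ c : Fin n → Curtain X, IsLChain L c ∧ ∀ i, (c i).Separates {a s} {a t} := by
  have hM : 0 ≤ 4 * R + 2 := by positivity
  have hsucc : ∀ {i m : ℕ}, i < m → (4 * R + 2) * (i + 1) ≤ (4 * R + 2) * m := fun him =>
    mul_le_mul_of_nonneg_left (by exact_mod_cast him) hM
  have hpos : ∀ i : Fin n, 0 ≤ (4 * R + 2) * (i : ℕ) := fun i => by positivity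
  obtain ⟨c, hc, hcoord⟩ := hX.exists_dual_curtains ha (by linarith : 1 < 4 * R + 2) (n := n)
    fun u hu => ha.ordConnected.out hs ht ⟨hu.1.le, by linarith [hu.2]⟩
  have hsep : ∀ i j : Fin n, i < j → IsLSeparated L (c i) (c j) := fun i j hij =>
    (h.mono (Icc_subset_Icc (by linarith [hpos i]) (by linarith [hsucc j.2]))).isLSeparated hX ha
      hR (by linarith [hsucc hij]) (hcoord i) (hcoord j) (hc.1 i j hij.ne) hL
  refine ⟨c, ⟨hc, fun i j hij => ?_⟩, fun i => ?_⟩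
  · rcases lt_or_gt_of_ne hij with hlt | hgt
    · exact hsep i j hlt
    · exact (hsep j i hgt).symm
  · rw [Curtain.isOrientation_coord.separates_iff hX]
    left
    simp only [mem_singleton_iff, forall_eq, hcoord, hX.projParam_self ha hs,
      hX.projParam_self ha ht]
    constructor <;> linarith [hpos i, hsucc i.2]

theorem IsContractingAtScale.le_dHat (hX : IsCAT0 X) {a : ℝ → X} {I : Set ℝ}
    (ha : IsClosedGeodesic a I) {R s t : ℝ} (hR : 0 < R) (hs : s ∈ I) (ht : t ∈ I) (hst : s < t)
    (h : IsContractingAtScale a I R (Icc s t)) :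
    ENNReal.ofReal ((t - s) / ((4 * R + 2) * (6 * R + 4) ^ 3)) ≤ dHat (a s) (a t) := by
  have hM : 0 < 4 * R + 2 := by positivity
  have hts : 0 ≤ t - s := sub_nonneg.2 hst.le
  have hn := Nat.floor_le (div_nonneg hts hM.le)
  rw [le_div_iff₀ hM, mul_comm] at hn
  obtain ⟨c, hc, hsep⟩ := h.exists_isLChain hX ha hR hs ht hn (Nat.le_ceil _)
  have hL : 0 < ⌈6 * R + 3⌉₊ := Nat.ceil_pos.2 (by positivity)
  have hne : a s ≠ a t := by
    rw [← dist_pos, ha.isGeodesicOn.dist_eq_sub hs ht hst.le]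
    exact sub_pos.2 hst
  refine (ENNReal.ofReal_le_ofReal ?_).trans (le_dHat_of_isLChain hL hne hc hsep)
  rw [← div_div]
  gcongr
  · exact (Nat.lt_floor_add_one _).le.trans_eq (add_comm _ _)
  · linarith [Nat.ceil_lt_add_one (by positivity : 0 ≤ 6 * R + 3)]

theorem IsContractingRay.hasPersistentShadow (hX : IsCAT0 X) (hκ : ∀ t, 0 ≤ t → 1 ≤ κ t)
    (hd : IsDoublingWith A κ) (hgrow : GrowsSublinearly κ) (hb : IsGeodesicRay o b)
    (h : IsContractingRay κ o b) : HasPersistentShadow (fun t => κ t ^ 4) b := by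
  obtain ⟨K, hK, hscale⟩ := h.exists_isContractingAtScale hκ hd hgrow hb
  refine ⟨1 / ((4 * K + 2) * (6 * K + 4) ^ 3), by positivity, fun s t hs hst => ?_⟩
  have ht : 0 ≤ t := hs.trans hst.le
  have hκt : 1 ≤ κ t := hκ t ht
  refine (ENNReal.ofReal_le_ofReal ?_).trans (((hscale t ht).mono (Icc_subset_Icc_left hs)).le_dHat
    hX hb.isClosedGeodesic (by positivity) (mem_Ici.2 hs) (mem_Ici.2 ht) hst)
  calc _ ≤ 1 / ((4 * K + 2) * (6 * K + 4) ^ 3) * ((t - s) / κ t ^ 4) :=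
        sub_le_self _ (by positivity)
    _ = (t - s) / ((4 * K * κ t + 2 * κ t) * (6 * K * κ t + 4 * κ t) ^ 3) := by
        rw [← add_mul, ← add_mul]
        field_simp
    _ ≤ _ := by
        rw [← mul_assoc 4, ← mul_assoc 6]
        gcongr <;> linarith

end ContractingRay

theorem theoremD_general {X : Type*} [MetricSpace X] (hX : IsCAT0 X) {κ : ℝ → ℝ} {A : ℝ}
    (hκ : ∀ t, 0 ≤ t → 1 ≤ κ t) (hd : IsDoublingWith A κ) {o : X} {b : ℝ → X}
    (hb : IsGeodesicRay o b) :
    (GrowsSublinearly κ → IsContractingRay κ o b → HasPersistentShadow (fun t => κ t ^ 4) b) ∧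
    (HasPersistentShadow κ b → IsContractingRay (fun t => κ t ^ 2) o b) :=
  ⟨fun hgrow h => h.hasPersistentShadow hX hκ hd hgrow hb,
    fun h => h.isContractingRay hX hκ hd hb⟩

theorem theoremD {X : Type*} [MetricSpace X] (hX : IsCAT0 X)
    (κ : ℝ → ℝ) (hκ : IsSublinearFunction κ)
    (o : X) (b : ℝ → X) (hb : IsGeodesicRay o b) (hdiam : HasInfiniteDiamHat b) :
    (IsContractingRay κ o b → GrowsSublinearly (fun t => κ t ^ 4) →
      HasPersistentShadow (fun t => κ t ^ 4) b) ∧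
    (HasPersistentShadow κ b → GrowsSublinearly (fun t => κ t ^ 2) →
      IsContractingRay (fun t => κ t ^ 2) o b) :=
  (theoremD_general hX hκ.one_le hκ.isDoublingWith hb).imp
    (fun shadow h _ => shadow hκ.growsSublinearly h) fun contracting h _ => contracting h
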